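/- Let $\Gamma$ be a countable discrete group and let $(X,T)$ be a $\Gamma$-dynamical system, i.e. $X$ is a compact metric space and $T:\Gamma\to\mathrm{Homeo}(X)$, $\gamma\mapsto T_\gamma$, is a homomorphism. Let $\mathrm{Prob}(X,T)$ be the set of $T$-invariant Borel probability measures on $X$ and $\mathrm{Cov}(X)$ the set of finite open covers of $X$. For covers write $\mathcal V\succeq\mathcal U$ if every $V\in\mathcal V$ is contained in some $U\in\mathcal U$, and put $\mathrm{ord}(\mathcal V,x)=-1+\sum_{V\in\mathcal V}\mathbf 1_V(x)$ and $\dim(\mathcal U)=\inf_{\mathcal V\in\mathrm{Cov}(X),\,\mathcal V\succeq\mathcal U}\ \sup_{x\in X}\mathrm{ord}(\mathcal V,x)$. Suprema and infima are taken in $[-\infty,+\infty]$. The dimension of $(X,T)$ is $$\dim(X,T)=\sup_{\mathcal U\in\mathrm{Cov}(X)}\ \inf_{\mathcal V\in\mathrm{Cov}(X),\,\mathcal V\succeq\mathcal U}\ \sup_{\mu\in\mathrm{Prob}(X,T)}\int_X\mathrm{ord}(\mathcal V,x)\,d\mu(x).$$ A Følner sequence is a sequence $(F_n)$ of nonempty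 finite subsets of $\Gamma$ with $|F_n\gamma\,\triangle\,F_n|/|F_n|\to0$ for every $\gamma\in\Gamma$; $\Gamma$ is amenable if one exists. For amenable $\Gamma$ the mean dimension is $$\mathrm{mdim}(X,T)=\sup_{\mathcal U\in\mathrm{Cov}(X)}\ \lim_{n\to\infty}\frac1{|F_n|}\dim\Big(\bigvee_{\gamma\in F_n}T_\gamma(\mathcal U)\Big),$$ where $\bigvee_{\gamma\in F}T_\gamma(\mathcal U)$ consists of the sets $\bigcap_{\gamma\in F}T_\gamma(U_\gamma)$ with all $U_\gamma\in\mathcal U$; it is part of the claims below that, for the systems considered, these limits exist and that the value is the same for every Følner sequence. The system $(X,T)$ has the uniform Rokhlin property if for every finite $K\subseteq\Gamma$ and every $\epsilon>0$ there are open sets $V_1,\dots,V_r\subseteq X$ and nonempty finite sets $S_1,\dots,S_r\subseteq\Gamma$ that are $(K,\epsilon)$-invariant (i.e. $|kS_i\,\triangle\,S_i|<\epsilon|S_i|$ for all $k\in K$) such that the sets $T_\gamma V_i$, indexed by the pairs $(i,\gamma)$ with $1\le i\le r$ and $\gamma\in S_i$, are pairwise disjoint and $\sup_{\mu\in\mathrm{Prob}(X,T)}\mu\big(X\setminus\bigcup_{i=1}^r\bigcup_{\gamma\in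 S_i}T_\gamma V_i\big)<\epsilon$. It has the marker property if for every finite $F\subseteq\Gamma$ there is an open $U\subseteq X$ with $U\cap T_\gamma U=\emptyset$ for all $\gamma\in F$ other than the identity and $\bigcup_{\gamma\in\Gamma}T_\gamma U=X$. **Theorem.** If $\Gamma$ is a countable amenable group and $(X,T)$ is a $\Gamma$-dynamical system with the uniform Rokhlin property, then $\mathrm{mdim}(X,T)=\dim(X,T)$. In particular, $\mathrm{mdim}(X,T)=\dim(X,T)$ holds for every $\mathbb Z^k$-dynamical system with the marker property, and for every $\mathbb Z^k$-dynamical system that is an extension of a free minimal $\mathbb Z^k$-dynamical system (i.e. that admits a continuous equivariant surjection onto it). -/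

import Mathlib

open scoped Pointwise symmDiff ENNReal Topology
open MeasureTheory Filter

namespace DynDim

noncomputable section

/-! ### Covers and their order -/

section Covers

variable {X : Type*}

/-- `ord(𝒱, x) = -1 + ∑_{V ∈ 𝒱} 1_V(x)` for a finite collection `𝒱` of subsets of `X`. -/
def ordAt (𝒱 : Finset (Set X)) (x : X) : ℝ :=
  -1 + ∑ V ∈ 𝒱, V.indicator (fun _ => (1 : ℝ)) x

/-- `ord(𝒱) = sup_{x ∈ X} ord(𝒱, x)`, which is `-∞` if `X` is empty. -/
def ord (𝒱 : Finset (Set X)) : EReal :=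
  ⨆ x : X, (ordAt 𝒱 x : EReal)

/-- `Refines 𝒱 𝒰`, i.e. `𝒱 ≽ 𝒰`: every element of `𝒱` is contained in some element of `𝒰`. -/
def Refines (𝒱 𝒰 : Set (Set X)) : Prop :=
  ∀ V ∈ 𝒱, ∃ U ∈ 𝒰, V ⊆ U

/-- A finite collection of subsets of `X` that is an open cover of `X`. -/
def IsOpenCover [TopologicalSpace X] (𝒰 : Finset (Set X)) : Prop :=
  (∀ U ∈ 𝒰, IsOpen U) ∧ ⋃ U ∈ 𝒰, U = Set.univ

/-- `dim(𝒰) = inf ord(𝒱)` over the finite open covers `𝒱` that refine `𝒰`. -/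
def coverDim [TopologicalSpace X] (𝒰 : Set (Set X)) : EReal :=
  ⨅ (𝒱 : Finset (Set X)) (_ : IsOpenCover 𝒱 ∧ Refines (𝒱 : Set (Set X)) 𝒰), ord 𝒱

/-- The joint refinement `⋁_{γ ∈ F} T_γ(𝒰)`: it consists of the sets `⋂_{γ ∈ F} T_γ(U_γ)` with
`U_γ ∈ 𝒰` for every `γ ∈ F`. -/
def iteratedJoin {Γ : Type*} [Group Γ] [MulAction Γ X] (F : Finset Γ) (𝒰 : Finset (Set X)) :
    Set (Set X) :=
  {A | ∃ u : Γ → Set X, (∀ γ ∈ F, u γ ∈ 𝒰) ∧ A = ⋂ γ ∈ F, γ • u γ}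

end Covers

/-! ### Amenability -/

section Groups

variable {Γ : Type*} [Group Γ]

open scoped Classical in
/-- `F` is a Følner sequence: a sequence of nonempty finite subsets of `Γ` such that
`|F_n γ ∆ F_n| / |F_n| → 0` for every `γ`. The translates are taken on the side that goes with the
joint refinements `⋁_{γ ∈ F_n} T_γ(𝒰)` of a left action. -/
def IsFolnerSeq (F : ℕ → Finset Γ) : Prop :=
  (∀ n, (F n).Nonempty) ∧
    ∀ γ : Γ, Tendsto
      (fun n => ((((F n).image (fun g => g * γ)) ∆ (F n)).card : ℝ) / ((F n).card : ℝ))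
      atTop (𝓝 0)

variable (Γ) in
/-- Amenability of a countable group, through the Følner criterion. -/
def IsAmenable : Prop :=
  ∃ F : ℕ → Finset Γ, IsFolnerSeq F

open scoped Classical in
/-- The finite set `S` is nonempty and `(K, ε)`-invariant: `|k S ∆ S| < ε |S|` for all `k ∈ K`. -/
def IsInvariantSet (K : Finset Γ) (ε : ℝ) (S : Finset Γ) : Prop :=
  S.Nonempty ∧
    ∀ k ∈ K, (((S.image (fun g => k * g)) ∆ S).card : ℝ) < ε * (S.card : ℝ)

end Groups

/-! ### Dynamical systems -/

section Systems

variable (Γ : Type*) [Group Γ] (X : Type*) [MulAction Γ X]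

/-- `Prob(X, T)`: the `T`-invariant Borel probability measures on `X`. -/
def invariantProb [MeasurableSpace X] : Set (Measure X) :=
  {μ | IsProbabilityMeasure μ ∧ SMulInvariantMeasure Γ X μ}

/-- `dim(X, T)`, the supremum over the finite open covers `𝒰` of `X` of the infimum over the finite
open covers `𝒱` refining `𝒰` of `sup_{μ ∈ Prob(X, T)} ∫ ord(𝒱, x) dμ(x)`. It is `-∞` if
`Prob(X, T)` is empty. -/
def dynDim [TopologicalSpace X] [MeasurableSpace X] : EReal :=
  ⨆ (𝒰 : Finset (Set X)) (_ : IsOpenCover 𝒰),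
    ⨅ (𝒱 : Finset (Set X)) (_ : IsOpenCover 𝒱 ∧ Refines (𝒱 : Set (Set X)) (𝒰 : Set (Set X))),
      ⨆ μ ∈ invariantProb Γ X, ((∫ x, ordAt 𝒱 x ∂μ : ℝ) : EReal)

/-- `mdim(X, T)` is defined and equal to `d`: the group is amenable, and for every Følner sequence
`(F_n)` and every finite open cover `𝒰` the limit
`L(𝒰) = lim_n dim(⋁_{γ ∈ F_n} T_γ(𝒰)) / |F_n|` exists, and `sup_𝒰 L(𝒰) = d`. -/
def HasMeanDim [TopologicalSpace X] (d : EReal) : Prop :=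
  IsAmenable Γ ∧
    ∀ F : ℕ → Finset Γ, IsFolnerSeq F →
      ∃ L : Finset (Set X) → EReal,
        (∀ 𝒰 : Finset (Set X), IsOpenCover 𝒰 →
          Tendsto (fun n => coverDim (iteratedJoin (F n) 𝒰) / ((F n).card : EReal))
            atTop (𝓝 (L 𝒰))) ∧
        ⨆ (𝒰 : Finset (Set X)) (_ : IsOpenCover 𝒰), L 𝒰 = d

/-- The capacity of `A`: the supremum of `μ(A)` over `μ ∈ Prob(X, T)`. -/
def capacity {X : Type*} [MulAction Γ X] [MeasurableSpace X] (A : Set X) : ℝ≥0∞ :=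
  ⨆ μ ∈ invariantProb Γ X, μ A

/-- The uniform Rokhlin property: for all finite `K ⊆ Γ` and `ε > 0` there are finitely many open
sets `V_i` and finite `(K, ε)`-invariant sets `S_i` such that the sets `T_γ V_i`, indexed by the
pairs `(i, γ)` with `γ ∈ S_i`, are pairwise disjoint and their union has a complement of capacity
less than `ε`. -/
def HasURP [TopologicalSpace X] [MeasurableSpace X] : Prop :=
  ∀ (K : Finset Γ) (ε : ℝ), 0 < ε →
    ∃ (r : ℕ) (V : Fin r → Set X) (S : Fin r → Finset Γ),
      (∀ i, IsOpen (V i)) ∧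
      (∀ i, IsInvariantSet K ε (S i)) ∧
      (∀ i, ∀ γ ∈ S i, ∀ j, ∀ δ ∈ S j, (i, γ) ≠ (j, δ) → Disjoint (γ • V i) (δ • V j)) ∧
      capacity Γ (⋃ i, ⋃ γ ∈ S i, γ • V i)ᶜ < ENNReal.ofReal ε

/-- The marker property: for every finite `F ⊆ Γ` there is an open set `U` whose translates cover
`X` and such that `U ∩ T_γ U = ∅` for every `γ ∈ F` other than the identity. -/
def HasMarkerProperty [TopologicalSpace X] : Prop :=
  ∀ F : Finset Γ, ∃ U : Set X, IsOpen U ∧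
    (∀ γ ∈ F, γ ≠ 1 → Disjoint U (γ • U)) ∧ ⋃ γ : Γ, γ • U = Set.univ

/-- The action is free: a point is fixed by no element other than the identity. -/
def IsFreeAction : Prop :=
  ∀ (γ : Γ) (x : X), γ • x = x → γ = 1

/-- `π : X → Y` makes `X` an extension of `Y`: it is continuous, equivariant and onto. -/
def IsFactorMap {X Y : Type*} [MulAction Γ X] [MulAction Γ Y] [TopologicalSpace X]
    [TopologicalSpace Y] (π : X → Y) : Prop :=
  Continuous π ∧ (∀ (γ : Γ) (x : X), π (γ • x) = γ • π x) ∧ Function.Surjective π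

end Systems

/-- The group `ℤᵏ`, written multiplicatively. -/
abbrev ZPow (k : ℕ) : Type := Multiplicative (Fin k → ℤ)

end

end DynDim

/-!
Fix a cover `𝒰` and compare `dim(⋁_{γ ∈ D} T_γ(𝒰)) / |D|`, for asymptotically invariant finite sets
`D`, with the quantity `inf_𝒱 sup_μ ∫ ord(𝒱, x) dμ`.

*Upper bound.* If all invariant means of `ord(𝒱, ·)` are less than `c`, then by compactness of the
space of probability measures the averages of `ord(T_γ(𝒱), ·)` over `γ` in a sufficiently invariant
`D` are less than `c` at every point, once `𝒱` is shrunk to closed sets. The open stars of a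
barycentric subdivision form a joint refinement of the covers `T_γ(𝒱)`, whose order is at most the
sum of their orders.

*Lower bound.* The order of the join is subadditive in `D`, so by the Ornstein–Weiss lemma a bound
along some asymptotically invariant sets holds for all sufficiently invariant sets, in particular
for the shapes `S` of the towers of the uniform Rokhlin property. A cover of order `d` can be split
into `|S|` covers that are subordinate to it and whose orders add up to at most `d` at every point;
placing one of these on each level of the tower, and `𝒰` itself on the small remainder, gives a
cover of `X` whose integrated order is at most that bound. The splitting compares a partition of
unity with generic weights: a bipartite graph with at least as many edges as vertices has a cycle,
and around a cycle generic weights do not cancel.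

For `ℤᵏ`, a continuous marker function assigns to each point a power diagram of `ℤᵏ` that is
equivariant along the orbit. Contracting the cells by a factor close to `1` opens gaps of any
prescribed width between them at a small loss of density, and then the cells, tiled by boxes, are
the required towers.
-/

namespace DynDim

open scoped Finset NNReal

/-! ### The Ornstein–Weiss lemma -/

section OrnsteinWeiss

variable {Γ : Type*} [Group Γ] [DecidableEq Γ]

/-- The number of elements of `D` that right multiplication by `g` moves out of `D`: a one-sided
substitute for `|D g ∆ D|`. -/
def escape (g : Γ) (D : Finset Γ) : ℕ := #{d ∈ D | d * g ∉ D}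

/-- The right-handed counterpart of `IsInvariantSet`, measured by `escape`: it is the notion of
invariance that is preserved by the left translations under which mean dimension is invariant. -/
def IsRightInvariantSet (K : Finset Γ) (δ : ℝ) (D : Finset Γ) : Prop :=
  D.Nonempty ∧ ∀ g ∈ K, (escape g D : ℝ) ≤ δ * #D

theorem IsRightInvariantSet.mono {K K' D : Finset Γ} {δ δ' : ℝ} (hD : IsRightInvariantSet K δ D)
    (hK : K' ⊆ K) (hδ : δ ≤ δ') : IsRightInvariantSet K' δ' D :=
  ⟨hD.1, fun g hg => (hD.2 g (hK hg)).trans (by gcongr)⟩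

variable (Γ) in
/-- The filter of asymptotically invariant finite sets; Følner sequences are sequences that tend to
it. -/
def folnerFilter : Filter (Finset Γ) :=
  ⨅ p : Finset Γ × Set.Ioi (0 : ℝ), 𝓟 {D | IsRightInvariantSet p.1 p.2 D}

theorem hasBasis_folnerFilter : (folnerFilter Γ).HasBasis (fun _ => True)
    fun p : Finset Γ × Set.Ioi (0 : ℝ) => {D | IsRightInvariantSet p.1 p.2 D} := by
  have : Nonempty (Finset Γ × Set.Ioi (0 : ℝ)) := ⟨∅, 1, Set.mem_Ioi.2 one_pos⟩
  refine hasBasis_iInf_principal fun p q =>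
    ⟨⟨p.1 ∪ q.1, min (p.2 : ℝ) q.2, Set.mem_Ioi.2 (lt_min p.2.2 q.2.2)⟩,
      fun D hD => ?_, fun D hD => ?_⟩
  · exact hD.mono Finset.subset_union_left (min_le_left (p.2 : ℝ) q.2)
  · exact hD.mono Finset.subset_union_right (min_le_right (p.2 : ℝ) q.2)

theorem eventually_folnerFilter {p : Finset Γ → Prop} :
    (∀ᶠ D in folnerFilter Γ, p D) ↔
      ∃ (K : Finset Γ) (δ : ℝ), 0 < δ ∧ ∀ D, IsRightInvariantSet K δ D → p D := by
  simp [hasBasis_folnerFilter.eventually_iff]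

theorem frequently_folnerFilter {p : Finset Γ → Prop} :
    (∃ᶠ D in folnerFilter Γ, p D) ↔
      ∀ (K : Finset Γ) (δ : ℝ), 0 < δ → ∃ D, IsRightInvariantSet K δ D ∧ p D := by
  simp [hasBasis_folnerFilter.frequently_iff]

theorem eventually_nonempty_folnerFilter : ∀ᶠ D in folnerFilter Γ, D.Nonempty :=
  eventually_folnerFilter.2 ⟨∅, 1, one_pos, fun _ hD => hD.1⟩

theorem eventually_isRightInvariantSet (K : Finset Γ) {δ : ℝ} (hδ : 0 < δ) :
    ∀ᶠ D in folnerFilter Γ, IsRightInvariantSet K δ D :=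
  eventually_folnerFilter.2 ⟨K, δ, hδ, fun _ => id⟩

theorem escape_smul (g c : Γ) (D : Finset Γ) : escape g (c • D) = escape g D := by
  have : {d ∈ c • D | d * g ∉ c • D} = c • {d ∈ D | d * g ∉ D} := by
    ext x
    simp only [Finset.mem_filter, ← Finset.inv_smul_mem_iff, smul_eq_mul, mul_assoc]
  rw [escape, this, Finset.card_smul_finset, escape]

theorem escape_union_le (g : Γ) (A B : Finset Γ) :
    escape g (A ∪ B) ≤ escape g A + escape g B := by
  refine (Finset.card_le_card fun x => ?_).trans (Finset.card_union_le _ _)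
  simp only [Finset.mem_filter, Finset.mem_union]
  tauto

theorem escape_sdiff_le (g : Γ) (D A : Finset Γ) :
    escape g (D \ A) ≤ escape g D + escape g⁻¹ A := by
  have hsub : {d ∈ D \ A | d * g ∉ D \ A} ⊆
      {d ∈ D | d * g ∉ D} ∪ {a ∈ A | a * g⁻¹ ∉ A}.image (· * g⁻¹) := by
    intro x
    simp only [Finset.mem_filter, Finset.mem_union, Finset.mem_sdiff, Finset.mem_image, not_and,
      not_not]
    rintro ⟨⟨hxD, hxA⟩, hxg⟩
    by_cases hxgD : x * g ∈ D
    · exact Or.inr ⟨x * g, ⟨hxg hxgD, by simpa using hxA⟩, by simp⟩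
    · exact Or.inl ⟨hxD, hxgD⟩
  exact (Finset.card_le_card hsub).trans
    ((Finset.card_union_le _ _).trans (Nat.add_le_add_left Finset.card_image_le _))

/-- A function `h` of finite subsets of a group that is invariant under left translations,
subadditive, and of at most linear growth, with rate `C`. -/
structure IsInvariantSubadditive (h : Finset Γ → ℝ) (C : ℝ) : Prop where
  rate_nonneg : 0 ≤ C
  le_mul_card : ∀ D, h D ≤ C * #D
  smul_eq : ∀ (c : Γ) (D : Finset Γ), h (c • D) = h D
  union_le : ∀ A B, h (A ∪ B) ≤ h A + h B

theorem isInvariantSubadditive_escape (g : Γ) :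
    IsInvariantSubadditive (fun D => (escape g D : ℝ)) 1 where
  rate_nonneg := zero_le_one
  le_mul_card D := by
    rw [one_mul]
    exact_mod_cast Finset.card_filter_le _ _
  smul_eq c D := by rw [escape_smul]
  union_le A B := by exact_mod_cast escape_union_le g A B

theorem IsInvariantSubadditive.mul_le {h : Finset Γ → ℝ} {C : ℝ} (hh : IsInvariantSubadditive h C)
    (S F : Finset Γ) : h (S * F) ≤ #S * h F := by
  rw [← smul_eq_mul, ← Finset.biUnion_smul_finset]
  induction S using Finset.induction_on with
  | empty => simpa using hh.le_mul_card ∅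
  | insert c S hc ih =>
    rw [Finset.biUnion_insert, Finset.card_insert_of_notMem hc]
    push_cast
    linarith [hh.union_le (c • F) (S.biUnion (· • F)), hh.smul_eq c F]

/-- The elements `c` for which the left translate `c F` lies in `D`. -/
def innerTranslates (F D : Finset Γ) : Finset Γ := {c ∈ D * F⁻¹ | c • F ⊆ D}

theorem mem_innerTranslates {F D : Finset Γ} (hF : F.Nonempty) {c : Γ} :
    c ∈ innerTranslates F D ↔ c • F ⊆ D := by
  simp only [innerTranslates, Finset.mem_filter, and_iff_right_iff_imp]
  intro hc
  obtain ⟨f, hf⟩ := hF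
  exact Finset.mem_mul.2
    ⟨c * f, hc (Finset.smul_mem_smul_finset hf), f⁻¹, Finset.inv_mem_inv hf, by simp⟩

theorem card_le_card_innerTranslates_add {F D : Finset Γ} {f₀ : Γ} (hf₀ : f₀ ∈ F) :
    #D ≤ #(innerTranslates F D) + ∑ f ∈ F, escape (f₀⁻¹ * f) D := by
  have hsub : D ⊆ (innerTranslates F D).image (· * f₀) ∪
      F.biUnion fun f => {d ∈ D | d * (f₀⁻¹ * f) ∉ D} := by
    intro d hd
    by_cases h : ∀ f ∈ F, d * (f₀⁻¹ * f) ∈ D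
    · refine Finset.mem_union_left _ (Finset.mem_image.2 ⟨d * f₀⁻¹, ?_, by simp⟩)
      rw [mem_innerTranslates ⟨f₀, hf₀⟩]
      intro x hx
      obtain ⟨f, hf, rfl⟩ := Finset.mem_smul_finset.1 hx
      simpa [mul_assoc] using h f hf
    · push Not at h
      obtain ⟨f, hf, hdf⟩ := h
      exact Finset.mem_union_right _ (Finset.mem_biUnion.2 ⟨f, hf, by simp [hd, hdf]⟩)
  exact (Finset.card_le_card hsub).trans ((Finset.card_union_le _ _).trans
    (Nat.add_le_add Finset.card_image_le Finset.card_biUnion_le))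

theorem IsRightInvariantSet.half_card_le_innerTranslates {F D : Finset Γ} {f₀ : Γ} (hf₀ : f₀ ∈ F)
    (hD : IsRightInvariantSet (f₀⁻¹ • F) (1 / (2 * #F)) D) :
    (#D : ℝ) / 2 ≤ #(innerTranslates F D) := by
  have hF : (#F : ℝ) ≠ 0 := by exact_mod_cast Finset.card_ne_zero_of_mem hf₀
  have hsum : ∑ f ∈ F, (escape (f₀⁻¹ * f) D : ℝ) ≤ #D / 2 := by
    calc ∑ f ∈ F, (escape (f₀⁻¹ * f) D : ℝ)
        ≤ #F • (1 / (2 * #F) * (#D : ℝ)) := Finset.sum_le_card_nsmul _ _ _ fun f hf =>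
          hD.2 _ (Finset.smul_mem_smul_finset hf)
      _ = #D / 2 := by rw [nsmul_eq_mul]; field_simp
  have hcard : (#D : ℝ) ≤ #(innerTranslates F D) + ∑ f ∈ F, (escape (f₀⁻¹ * f) D : ℝ) := by
    exact_mod_cast card_le_card_innerTranslates_add hf₀
  linarith

theorem sum_card_smul_inter_le (P F A : Finset Γ) : ∑ c ∈ P, #(c • F ∩ A) ≤ #F * #A := by
  have hcard : ∀ c, #(c • F ∩ A) = ∑ f ∈ F, if c * f ∈ A then 1 else 0 := by
    intro c
    have : c • F ∩ A = c • {f ∈ F | c * f ∈ A} := by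
      ext x
      simp [← Finset.inv_smul_mem_iff]
    rw [← Finset.card_filter, this, Finset.card_smul_finset]
  simp only [hcard]
  rw [Finset.sum_comm, ← smul_eq_mul]
  refine Finset.sum_le_card_nsmul _ _ _ fun f _ => ?_
  rw [← Finset.card_filter, ← Finset.card_image_of_injective _ (mul_left_injective f)]
  refine Finset.card_le_card fun x hx => ?_
  obtain ⟨c, hc, rfl⟩ := Finset.mem_image.1 hx
  exact (Finset.mem_filter.1 hc).2

theorem mul_card_le_of_forall_le_card_smul_inter {P F A : Finset Γ} (hF : F.Nonempty) {ε : ℝ}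
    (h : ∀ c ∈ P, ε * #F ≤ #(c • F ∩ A)) : ε * #P ≤ #A := by
  have hFpos : (0 : ℝ) < #F := by exact_mod_cast hF.card_pos
  refine le_of_mul_le_mul_left ?_ hFpos
  calc #F * (ε * #P) = ∑ _c ∈ P, ε * #F := by rw [Finset.sum_const, nsmul_eq_mul]; ring
    _ ≤ ∑ c ∈ P, (#(c • F ∩ A) : ℝ) := Finset.sum_le_sum h
    _ ≤ #F * #A := by exact_mod_cast sum_card_smul_inter_le P F A

theorem exists_almostDisjoint_translates {F : Finset Γ} (hF : F.Nonempty) (P : Finset Γ) {ε : ℝ}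
    (hε : ε < 1) :
    ∃ S ⊆ P, (1 - ε) * (#S * #F) ≤ #(S * F) ∧ ε * #P ≤ #(S * F) := by
  have : (0 : ℝ) < #F := by exact_mod_cast hF.card_pos
  obtain ⟨S, hS, hmax⟩ := Finset.exists_max_image
    {S ∈ P.powerset | (1 - ε) * (#S * #F) ≤ (#(S * F) : ℝ)} Finset.card ⟨∅, by simp⟩
  simp only [Finset.mem_filter, Finset.mem_powerset] at hS hmax
  refine ⟨S, hS.1, hS.2, mul_card_le_of_forall_le_card_smul_inter hF fun c hc => ?_⟩
  by_contra! hlt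
  have hcS : c ∉ S := by
    intro hcS
    rw [← smul_eq_mul, Finset.inter_eq_left.2 (Finset.smul_finset_subset_smul hcS),
      Finset.card_smul_finset] at hlt
    nlinarith
  have hinsert : (#(insert c S * F) : ℝ) + #(c • F ∩ (S * F)) = #F + #(S * F) := by
    rw [Finset.insert_eq, Finset.union_mul, ← smul_eq_mul {c} F, Finset.singleton_smul]
    exact_mod_cast (Finset.card_smul_finset c F) ▸ Finset.card_union_add_card_inter (c • F) (S * F)
  have hle := hmax (insert c S) ⟨Finset.insert_subset hc hS.1, by
    rw [Finset.card_insert_of_notMem hcS]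
    push_cast
    linarith [hS.2]⟩
  rw [Finset.card_insert_of_notMem hcS] at hle
  omega

theorem exists_quasiTiling {F : Finset Γ} {f₀ : Γ} (hf₀ : f₀ ∈ F) {ε : ℝ} (hε0 : 0 < ε)
    (hε1 : ε < 1) {D : Finset Γ} (hD : IsRightInvariantSet (f₀⁻¹ • F) (1 / (2 * #F)) D) :
    ∃ S : Finset Γ, S * F ⊆ D ∧ (1 - ε) * (#S * #F) ≤ #(S * F) ∧ ε / 2 * #D ≤ #(S * F) := by
  obtain ⟨S, hS, hdisj, hbig⟩ :=
    exists_almostDisjoint_translates ⟨f₀, hf₀⟩ (innerTranslates F D) hε1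
  refine ⟨S, ?_, hdisj, ?_⟩
  · rw [← smul_eq_mul, ← Finset.biUnion_smul_finset]
    exact Finset.biUnion_subset.2 fun c hc => (mem_innerTranslates ⟨f₀, hf₀⟩).1 (hS hc)
  · nlinarith [hD.half_card_le_innerTranslates hf₀]

/-- If an almost disjoint union `S F` of translates of an invariant set does not exhaust an
invariant set `D`, then the rest of `D` is still invariant. -/
theorem IsRightInvariantSet.sdiff_mul {K F S D : Finset Γ} {δ ε : ℝ} (hδ : 0 < δ) (hε0 : 0 < ε)
    (hF : IsRightInvariantSet K⁻¹ (δ * ε * (1 - ε) / 2) F)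
    (hD : IsRightInvariantSet K (δ * ε / 2) D) (hSD : S * F ⊆ D)
    (hS : (1 - ε) * (#S * #F) ≤ #(S * F)) (hrest : ε * #D < #(D \ (S * F))) :
    IsRightInvariantSet K δ (D \ (S * F)) := by
  have hpos : (0 : ℝ) < #(D \ (S * F)) := lt_of_le_of_lt (by positivity) hrest
  refine ⟨Finset.card_pos.1 (by exact_mod_cast hpos), fun g hg => ?_⟩
  have hmul : (escape g⁻¹ (S * F) : ℝ) ≤ δ * ε / 2 * #D := by
    calc (escape g⁻¹ (S * F) : ℝ) ≤ #S * escape g⁻¹ F :=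
          (isInvariantSubadditive_escape g⁻¹).mul_le S F
      _ ≤ #S * (δ * ε * (1 - ε) / 2 * #F) := by
          gcongr
          exact hF.2 _ (Finset.inv_mem_inv hg)
      _ = δ * ε / 2 * ((1 - ε) * (#S * #F)) := by ring
      _ ≤ δ * ε / 2 * #D := by
          gcongr
          exact hS.trans (by exact_mod_cast Finset.card_le_card hSD)
  calc (escape g (D \ (S * F)) : ℝ) ≤ escape g D + escape g⁻¹ (S * F) := by
        exact_mod_cast escape_sdiff_le g D (S * F)
    _ ≤ δ * (ε * #D) := by linarith [hD.2 g hg]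
    _ ≤ δ * #(D \ (S * F)) := by gcongr

variable {h : Finset Γ → ℝ} {C a : ℝ}

theorem IsInvariantSubadditive.le_of_quasiTiling (hh : IsInvariantSubadditive h C) (ha : 0 ≤ a)
    {S F : Finset Γ} (hF : h F ≤ a * #F) {ε : ℝ} (hε1 : ε < 1)
    (hS : (1 - ε) * (#S * #F) ≤ #(S * F)) : h (S * F) ≤ a / (1 - ε) * #(S * F) := by
  have hε : 0 < 1 - ε := by linarith
  calc h (S * F) ≤ #S * h F := hh.mul_le S F
    _ ≤ #S * (a * #F) := by gcongr
    _ = a * ((1 - ε) * (#S * #F)) / (1 - ε) := by field_simp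
    _ ≤ a * #(S * F) / (1 - ε) := by gcongr
    _ = a / (1 - ε) * #(S * F) := by ring

/-- One round of quasi-tiling covers at least the proportion `ε / 2` of `D` at the cost of
`a / (1 - ε)` per element, which improves the excess `c` of the bound to `c'`. -/
theorem IsInvariantSubadditive.eventually_le_improve (hh : IsInvariantSubadditive h C)
    (ha : 0 ≤ a) (hfreq : ∃ᶠ F in folnerFilter Γ, h F ≤ a * #F) {ε : ℝ} (hε0 : 0 < ε)
    (hε1 : ε < 1) {c c' : ℝ} (hc0 : 0 ≤ c) (hCc' : C * ε ≤ c') (hcc' : c * (1 - ε / 2) ≤ c')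
    (hc : ∀ᶠ D in folnerFilter Γ, h D ≤ (a / (1 - ε) + c) * #D) :
    ∀ᶠ D in folnerFilter Γ, h D ≤ (a / (1 - ε) + c') * #D := by
  have : 0 < 1 - ε := by linarith
  obtain ⟨K, δ, hδ, hK⟩ := eventually_folnerFilter.1 hc
  obtain ⟨F, hFinv, hFa⟩ := frequently_folnerFilter.1 hfreq K⁻¹ (δ * ε * (1 - ε) / 2)
    (by positivity)
  obtain ⟨f₀, hf₀⟩ := hFinv.1
  have hFpos : (0 : ℝ) < #F := by exact_mod_cast hFinv.1.card_pos
  filter_upwards [eventually_isRightInvariantSet K (δ := δ * ε / 2) (by positivity),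
    eventually_isRightInvariantSet (f₀⁻¹ • F) (δ := 1 / (2 * #F)) (by positivity)] with D hDK hDF
  obtain ⟨S, hSD, hS, hbig⟩ := exists_quasiTiling hf₀ hε0 hε1 hDF
  have hcard : (#(D \ (S * F)) : ℝ) + #(S * F) = #D := by
    exact_mod_cast Finset.card_sdiff_add_card_eq_card hSD
  have hrest : h (D \ (S * F)) ≤ a / (1 - ε) * #(D \ (S * F)) + c' * #D := by
    rcases le_or_gt (#(D \ (S * F)) : ℝ) (ε * #D) with hsmall | hlarge
    · calc h (D \ (S * F)) ≤ C * #(D \ (S * F)) := hh.le_mul_card _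
        _ ≤ C * (ε * #D) := mul_le_mul_of_nonneg_left hsmall hh.rate_nonneg
        _ = C * ε * #D := by ring
        _ ≤ c' * #D := by gcongr
        _ ≤ a / (1 - ε) * #(D \ (S * F)) + c' * #D := le_add_of_nonneg_left (by positivity)
    · calc h (D \ (S * F)) ≤ (a / (1 - ε) + c) * #(D \ (S * F)) :=
            hK _ (hFinv.sdiff_mul hδ hε0 hDK hSD hS hlarge)
        _ = a / (1 - ε) * #(D \ (S * F)) + c * #(D \ (S * F)) := by ring
        _ ≤ a / (1 - ε) * #(D \ (S * F)) + c * ((1 - ε / 2) * #D) := by gcongr; linarith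
        _ = a / (1 - ε) * #(D \ (S * F)) + c * (1 - ε / 2) * #D := by ring
        _ ≤ a / (1 - ε) * #(D \ (S * F)) + c' * #D := by gcongr
  calc h D ≤ h (S * F) + h (D \ (S * F)) := by
        simpa only [Finset.union_sdiff_of_subset hSD] using hh.union_le (S * F) (D \ (S * F))
    _ ≤ a / (1 - ε) * #(S * F) + (a / (1 - ε) * #(D \ (S * F)) + c' * #D) :=
        add_le_add (hh.le_of_quasiTiling ha hFa hε1 hS) hrest
    _ = (a / (1 - ε) + c') * #D := by rw [← hcard]; ring

theorem IsInvariantSubadditive.eventually_le_iterate (hh : IsInvariantSubadditive h C)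
    (ha : 0 ≤ a) (hfreq : ∃ᶠ F in folnerFilter Γ, h F ≤ a * #F) {ε : ℝ} (hε0 : 0 < ε)
    (hε1 : ε < 1) (N : ℕ) :
    ∀ᶠ D in folnerFilter Γ, h D ≤ (a / (1 - ε) + (C * ε + C * (1 - ε / 2) ^ N)) * #D := by
  have hC := hh.rate_nonneg
  have : 0 < 1 - ε := by linarith
  have hq : 0 ≤ 1 - ε / 2 := by linarith
  induction N with
  | zero =>
    refine Eventually.of_forall fun D => (hh.le_mul_card D).trans ?_
    gcongr
    rw [pow_zero, mul_one, ← add_assoc]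
    exact le_add_of_nonneg_left (by positivity)
  | succ N ih =>
    refine hh.eventually_le_improve ha hfreq hε0 hε1 (by positivity) ?_ ?_ ih
    · exact le_add_of_nonneg_right (by positivity)
    · rw [pow_succ]
      nlinarith [mul_nonneg hC (mul_nonneg hε0.le hε0.le)]

/-- The Ornstein–Weiss lemma. -/
theorem IsInvariantSubadditive.eventually_le_of_frequently_le (hh : IsInvariantSubadditive h C)
    (ha : 0 ≤ a) (hfreq : ∃ᶠ F in folnerFilter Γ, h F ≤ a * #F) {b : ℝ} (hab : a < b) :
    ∀ᶠ D in folnerFilter Γ, h D ≤ b * #D := by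
  have hε : Tendsto (fun ε : ℝ => a / (1 - ε) + C * ε) (𝓝[>] 0) (𝓝 (a / (1 - 0) + C * 0)) := by
    refine Tendsto.mono_left (ContinuousAt.tendsto ?_) nhdsWithin_le_nhds
    exact ((continuousAt_const.div (by fun_prop) (by norm_num)).add (by fun_prop))
  obtain ⟨ε, ⟨hεb, hε1 : ε < 1⟩, hε0 : 0 < ε⟩ :=
    (((hε.eventually_lt_const (u := b) (by simpa using hab)).and
      (nhdsWithin_le_nhds (eventually_lt_nhds one_pos))).and self_mem_nhdsWithin).exists
  have hN : Tendsto (fun N : ℕ => a / (1 - ε) + (C * ε + C * (1 - ε / 2) ^ N)) atTop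
      (𝓝 (a / (1 - ε) + (C * ε + C * 0))) :=
    (((tendsto_pow_atTop_nhds_zero_of_lt_one (by linarith) (by linarith)).const_mul C).const_add
      _).const_add _
  obtain ⟨N, hNb⟩ := (hN.eventually_lt_const (u := b) (by simpa using hεb)).exists
  filter_upwards [hh.eventually_le_iterate ha hfreq hε0 hε1 N] with D hD
  exact hD.trans (by gcongr)

end OrnsteinWeiss

section Folner

variable {Γ : Type*} [Group Γ] [DecidableEq Γ]

theorem card_image_symmDiff_eq_two_mul {α : Type*} [DecidableEq α] {f : α → α}
    (hf : f.Injective) (D : Finset α) : #(D.image f ∆ D) = 2 * #{d ∈ D | f d ∉ D} := by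
  have hsdiff : D.image f \ D = {d ∈ D | f d ∉ D}.image f := by
    ext
    simp only [Finset.mem_sdiff, Finset.mem_image, Finset.mem_filter]
    grind
  rw [symmDiff_def, Finset.sup_eq_union, Finset.card_union_of_disjoint disjoint_sdiff_sdiff,
    ← Finset.card_sdiff_comm (Finset.card_image_of_injective D hf), hsdiff,
    Finset.card_image_of_injective _ hf, two_mul]

theorem card_filter_apply_notMem_le_card_image_symmDiff {α : Type*} [DecidableEq α] {f : α → α}
    (hf : f.Injective) (D : Finset α) : #{d ∈ D | f d ∉ D} ≤ #(D.image f ∆ D) := by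
  rw [card_image_symmDiff_eq_two_mul hf]
  exact Nat.le_mul_of_pos_left _ two_pos

theorem IsFolnerSeq.tendsto_folnerFilter {F : ℕ → Finset Γ} (hF : IsFolnerSeq F) :
    Tendsto F atTop (folnerFilter Γ) := by
  refine hasBasis_folnerFilter.tendsto_right_iff.2 fun ⟨K, δ, hδ⟩ _ => ?_
  have hK : ∀ᶠ n in atTop, ∀ g ∈ K, (escape g (F n) : ℝ) ≤ δ * #(F n) := by
    refine (Finset.eventually_all K).2 fun g _ => ?_
    filter_upwards [(hF.2 g).eventually_lt_const hδ] with n hn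
    rw [div_lt_iff₀ (by exact_mod_cast (hF.1 n).card_pos)] at hn
    refine (Nat.cast_le.2 ?_).trans hn.le
    rw [escape]
    convert card_filter_apply_notMem_le_card_image_symmDiff (mul_left_injective g) (F n)
  filter_upwards [hK] with n hn
  exact ⟨hF.1 n, hn⟩

theorem IsInvariantSet.isRightInvariantSet_inv {K S : Finset Γ} {ε : ℝ}
    (hS : IsInvariantSet K⁻¹ ε S) : IsRightInvariantSet K ε S⁻¹ := by
  refine ⟨hS.1.inv, fun g hg => ?_⟩
  rw [Finset.card_inv]
  refine (Nat.cast_le.2 ?_).trans (hS.2 g⁻¹ (Finset.inv_mem_inv hg)).le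
  have hinv : {d ∈ S⁻¹ | d * g ∉ S⁻¹} = {s ∈ S | g⁻¹ * s ∉ S}⁻¹ := by
    ext d
    simp
  rw [escape, hinv, Finset.card_inv]
  convert card_filter_apply_notMem_le_card_image_symmDiff (mul_right_injective g⁻¹) S

end Folner

section Boxes

/-- The box `[0, ℓ)ᵏ` in `ℤᵏ`. -/
noncomputable def intBox (k ℓ : ℕ) : Finset (Fin k → ℤ) :=
  Fintype.piFinset fun _ => Finset.Ico 0 (ℓ : ℤ)

theorem mem_intBox {k ℓ : ℕ} {v : Fin k → ℤ} : v ∈ intBox k ℓ ↔ ∀ i, 0 ≤ v i ∧ v i < ℓ := by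
  simp [intBox]

theorem card_intBox (k ℓ : ℕ) : #(intBox k ℓ) = ℓ ^ k := by
  simp [intBox, Fintype.card_piFinset]

/-- The box `[0, ℓ)ᵏ` in the multiplicatively written group `ZPow k`. -/
noncomputable def box (k ℓ : ℕ) : Finset (ZPow k) :=
  (intBox k ℓ).map Multiplicative.ofAdd.toEmbedding

theorem mem_box {k ℓ : ℕ} {g : ZPow k} : g ∈ box k ℓ ↔ g.toAdd ∈ intBox k ℓ := by
  simp [box]

theorem card_box (k ℓ : ℕ) : #(box k ℓ) = ℓ ^ k := by
  simp [box, card_intBox]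

theorem box_nonempty (k : ℕ) {ℓ : ℕ} (hℓ : 0 < ℓ) : (box k ℓ).Nonempty := by
  rw [← Finset.card_pos, card_box]
  positivity

theorem pow_le_card_filter_mul_mem_box {k ℓ A : ℕ} {a : ZPow k} (ha : ∀ i, |a.toAdd i| ≤ A) :
    (ℓ - 2 * A) ^ k ≤ #{g ∈ box k ℓ | g * a ∈ box k ℓ} := by
  calc (ℓ - 2 * A) ^ k
      = #((Fintype.piFinset fun _ : Fin k => Finset.Ico (A : ℤ) (ℓ - A)).map
          Multiplicative.ofAdd.toEmbedding) := by
        rw [Finset.card_map, Fintype.card_piFinset]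
        simp only [Int.card_Ico, Finset.prod_const, Finset.card_univ, Fintype.card_fin]
        congr 1
        omega
    _ ≤ _ := Finset.card_le_card fun g hg => by
        obtain ⟨v, hv, rfl⟩ := Finset.mem_map.1 hg
        simp only [Fintype.mem_piFinset, Finset.mem_Ico] at hv
        simp only [Finset.mem_filter, mem_box, mem_intBox, Equiv.coe_toEmbedding, toAdd_mul,
          toAdd_ofAdd, Pi.add_apply]
        have := fun i => abs_le.1 (ha i)
        grind

theorem escape_box_le {k ℓ A : ℕ} (hA : 2 * A ≤ ℓ) {a : ZPow k} (ha : ∀ i, |a.toAdd i| ≤ A) :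
    (escape a (box k ℓ) : ℝ) ≤ (ℓ : ℝ) ^ k - ((ℓ : ℝ) - 2 * A) ^ k := by
  have hstay : ((ℓ : ℝ) - 2 * A) ^ k ≤ #{g ∈ box k ℓ | g * a ∈ box k ℓ} := by
    have := (Nat.cast_le (α := ℝ)).2 (pow_le_card_filter_mul_mem_box (ℓ := ℓ) ha)
    push_cast [Nat.cast_sub hA] at this
    exact this
  have hsplit : (#{g ∈ box k ℓ | g * a ∈ box k ℓ} : ℝ) + escape a (box k ℓ) = (ℓ : ℝ) ^ k := by
    rw [escape]
    exact_mod_cast (Finset.card_filter_add_card_filter_not _).trans (card_box k ℓ)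
  linarith

theorem tendsto_card_image_mul_box_symmDiff (k : ℕ) (a : ZPow k) :
    Tendsto (fun ℓ : ℕ => (#((box k ℓ).image (· * a) ∆ box k ℓ) : ℝ) / #(box k ℓ))
      atTop (𝓝 0) := by
  obtain ⟨A, hA⟩ : ∃ A : ℕ, ∀ i, |a.toAdd i| ≤ A := by
    obtain ⟨A, hA⟩ := (Set.finite_range fun i => (a.toAdd i).natAbs).bddAbove
    exact ⟨A, fun i => by rw [Int.abs_eq_natAbs]; exact_mod_cast hA ⟨i, rfl⟩⟩
  have hlim : Tendsto (fun ℓ : ℕ => 2 * (1 - (1 - 2 * (A : ℝ) / ℓ) ^ k)) atTop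
      (𝓝 (2 * (1 - (1 - 0) ^ k))) := by
    have : Tendsto (fun ℓ : ℕ => 2 * (A : ℝ) / ℓ) atTop (𝓝 0) :=
      tendsto_const_nhds.div_atTop tendsto_natCast_atTop_atTop
    exact ((this.const_sub 1).pow k |>.const_sub 1).const_mul 2
  simp only [sub_zero, one_pow, sub_self, mul_zero] at hlim
  refine squeeze_zero' (Eventually.of_forall fun ℓ => by positivity) ?_ hlim
  filter_upwards [eventually_ge_atTop (2 * A), eventually_gt_atTop 0] with ℓ hℓ hℓ0
  have hesc := escape_box_le hℓ hA
  have hscale : (ℓ : ℝ) - 2 * A = (1 - 2 * A / ℓ) * ℓ := by field_simp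
  rw [hscale, mul_pow] at hesc
  rw [card_image_symmDiff_eq_two_mul (mul_left_injective a), card_box, ← escape]
  push_cast
  rw [div_le_iff₀ (by positivity)]
  linarith

theorem isAmenable_zPow (k : ℕ) : IsAmenable (ZPow k) := by
  refine ⟨fun n => box k (n + 1), fun n => box_nonempty k n.succ_pos, fun γ => ?_⟩
  refine ((tendsto_card_image_mul_box_symmDiff k γ).comp (tendsto_add_atTop_nat 1)).congr
    fun n => ?_
  simp only [Function.comp_apply]
  congr!

theorem exists_isInvariantSet_box (k : ℕ) (K : Finset (ZPow k)) {ε : ℝ} (hε : 0 < ε) :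
    ∃ ℓ : ℕ, 0 < ℓ ∧ IsInvariantSet K ε (box k ℓ) := by
  have hK := (Finset.eventually_all K).2 fun a _ =>
    (tendsto_card_image_mul_box_symmDiff k a).eventually_lt_const hε
  obtain ⟨ℓ, hℓ, hpos⟩ := (hK.and (eventually_gt_atTop 0)).exists
  refine ⟨ℓ, hpos, box_nonempty k hpos, fun a ha => ?_⟩
  have hlt := hℓ a ha
  rw [div_lt_iff₀ (by exact_mod_cast (box_nonempty k hpos).card_pos)] at hlt
  simp only [mul_comm a]
  convert! hlt

end Boxes

/-! ### Power diagrams of `ℤᵏ` -/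

section PowerDiagram

variable {k : ℕ}

/-- The squared Euclidean distance between a point of `ℝᵏ` and a point of `ℤᵏ`. -/
def sqDist (v : Fin k → ℝ) (n : Fin k → ℤ) : ℝ := ∑ i, (v i - n i) ^ 2

theorem sqDist_nonneg (v : Fin k → ℝ) (n : Fin k → ℤ) : 0 ≤ sqDist v n :=
  Finset.sum_nonneg fun _ _ => sq_nonneg _

theorem sqDist_add_intCast (v : Fin k → ℝ) (n z : Fin k → ℤ) :
    sqDist (fun i => v i + z i) (n + z) = sqDist v n := by
  simp [sqDist]

theorem abs_sub_le_of_sqDist_le {v : Fin k → ℝ} {n : Fin k → ℤ} {R : ℝ} (hR : 1 ≤ R)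
    (h : sqDist v n ≤ R) (i : Fin k) : |v i - n i| ≤ R := by
  refine abs_le_of_sq_le_sq ?_ (by linarith)
  calc (v i - n i) ^ 2 ≤ sqDist v n :=
        Finset.single_le_sum (fun j _ => sq_nonneg (v j - n j)) (Finset.mem_univ i)
    _ ≤ R := h
    _ ≤ R ^ 2 := by nlinarith

theorem finite_sqDist_le (v : Fin k → ℝ) (R : ℝ) : {n : Fin k → ℤ | sqDist v n ≤ R}.Finite := by
  refine (Set.finite_Icc (fun i => ⌈v i - max R 1⌉) (fun i => ⌊v i + max R 1⌋)).subset
    fun n hn => ?_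
  have hbound : ∀ i, |v i - n i| ≤ max R 1 :=
    abs_sub_le_of_sqDist_le (le_max_right _ _) (hn.trans (le_max_left _ _))
  refine ⟨fun i => Int.ceil_le.2 ?_, fun i => Int.le_floor.2 ?_⟩ <;>
    linarith [(abs_le.1 (hbound i)).1, (abs_le.1 (hbound i)).2]

/-- The point `v` lies in the cell of the site `n` in the power diagram of `ℤᵏ` with additive
weights `h`. -/
def Owns (h : (Fin k → ℤ) → ℝ) (n : Fin k → ℤ) (v : Fin k → ℝ) : Prop :=
  ∀ m, sqDist v n + h n ≤ sqDist v m + h m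

/-- The point `v` lies in the cell of the site `n` and in no other cell of the power diagram with
additive weights `h`. -/
def StrictlyOwns (h : (Fin k → ℤ) → ℝ) (n : Fin k → ℤ) (v : Fin k → ℝ) : Prop :=
  ∀ m, m ≠ n → sqDist v n + h n < sqDist v m + h m

theorem StrictlyOwns.eq {h : (Fin k → ℤ) → ℝ} {n m : Fin k → ℤ} {v : Fin k → ℝ}
    (hn : StrictlyOwns h n v) (hm : StrictlyOwns h m v) : n = m := by
  by_contra hne
  exact lt_asymm (hn m (Ne.symm hne)) (hm n hne)

theorem strictlyOwns_shift (h : (Fin k → ℤ) → ℝ) (z n : Fin k → ℤ) (v : Fin k → ℝ) :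
    StrictlyOwns (fun m => h (m + z)) n v ↔ StrictlyOwns h (n + z) fun i => v i + z i := by
  refine ((Equiv.addRight z).forall_congr fun m => ?_)
  simp [sqDist_add_intCast]

theorem exists_owns {h : (Fin k → ℤ) → ℝ} (hh : ∀ n, 0 ≤ h n) (u : Fin k → ℝ) :
    ∃ n, Owns h n u := by
  have hfin : {n : Fin k → ℤ | sqDist u n + h n ≤ sqDist u 0 + h 0}.Finite :=
    (finite_sqDist_le u (sqDist u 0 + h 0)).subset fun n hn =>
      (le_add_of_nonneg_right (hh n)).trans hn
  obtain ⟨n, hn, hmin⟩ := Set.exists_min_image _ (fun n => sqDist u n + h n) hfin ⟨0, by simp⟩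
  exact ⟨n, fun m => (le_total (sqDist u m + h m) (sqDist u 0 + h 0)).elim (hmin m) hn.trans⟩

theorem isOpen_setOf_strictlyOwns {X : Type*} [TopologicalSpace X] {H : X → (Fin k → ℤ) → ℝ} {M : ℝ}
    (hcont : ∀ m, Continuous fun x => H x m) (hH0 : ∀ x m, 0 ≤ H x m) (hHM : ∀ x m, H x m ≤ M)
    (n : Fin k → ℤ) (v : Fin k → ℝ) : IsOpen {x | StrictlyOwns (H x) n v} := by
  have hfin : {x | StrictlyOwns (H x) n v} = ⋂ m ∈ {m | sqDist v m ≤ sqDist v n + M},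
      {x | m ≠ n → sqDist v n + H x n < sqDist v m + H x m} := by
    ext x
    simp only [Set.mem_iInter]
    refine ⟨fun h m _ => h m, fun h m hm => ?_⟩
    by_cases hmM : sqDist v m ≤ sqDist v n + M
    · exact h m hmM hm
    · linarith [hHM x n, hH0 x m]
  rw [hfin]
  refine (finite_sqDist_le v _).isOpen_biInter fun m _ => ?_
  by_cases hm : m = n
  · simp [hm]
  · simpa [hm] using isOpen_lt ((hcont n).const_add _) ((hcont m).const_add _)

/-- Weights on `ℤᵏ` with values in `[0, M]`, for which distinct sites of weight less than `M` are
at distance more than `r` and the sites of weight zero are relatively dense. -/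
structure GoodWeights (h : (Fin k → ℤ) → ℝ) (M Λ : ℝ) (r : ℕ) : Prop where
  nonneg : ∀ n, 0 ≤ h n
  le : ∀ n, h n ≤ M
  separated : ∀ n m, h n < M → h m < M → n ≠ m → ∃ i, (r : ℤ) < |n i - m i|
  dense : ∀ u : Fin k → ℝ, ∃ n, h n = 0 ∧ sqDist u n ≤ Λ

theorem GoodWeights.cost_le {h : (Fin k → ℤ) → ℝ} {M Λ : ℝ} {r : ℕ} (hg : GoodWeights h M Λ r)
    {n : Fin k → ℤ} {u : Fin k → ℝ} (hn : Owns h n u) : sqDist u n + h n ≤ Λ := by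
  obtain ⟨g, hg0, hgΛ⟩ := hg.dense u
  linarith [hn g]

/-- The constraints under which contracting the cells by the factor `s` leaves room of radius `ρ`
around every contracted point. -/
structure IsContractionScale (k : ℕ) (s ρ M Λ : ℝ) (r : ℕ) : Prop where
  pos : 0 < s
  lt_one : s < 1
  nonneg : 0 ≤ ρ
  lt_separation : k * (ρ ^ 2 / (1 - s)) + 2 * ρ < (1 - s) * r
  lt_height : k * (ρ ^ 2 / (1 - s)) < s * (M - Λ)

theorem IsContractionScale.height_nonneg {s ρ M : ℝ} {Λ r : ℕ}
    (hs : IsContractionScale k s ρ M Λ r) : 0 ≤ M := by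
  have hs1 := sub_pos.2 hs.lt_one
  have hMΛ : 0 < M - Λ :=
    pos_of_mul_pos_right (lt_of_le_of_lt (by positivity) hs.lt_height) hs.pos.le
  linarith [Λ.cast_nonneg (α := ℝ)]

theorem exists_isContractionScale (k : ℕ) {s ρ : ℝ} (hs0 : 0 < s) (hs1 : s < 1) (hρ : 0 ≤ ρ) :
    ∃ r : ℕ, ∀ Λ, ∃ M, IsContractionScale k s ρ M Λ r := by
  set c : ℝ := k * (ρ ^ 2 / (1 - s))
  obtain ⟨r, hr⟩ := exists_nat_gt ((c + 2 * ρ) / (1 - s))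
  rw [div_lt_iff₀' (sub_pos.2 hs1)] at hr
  refine ⟨r, fun Λ => ⟨Λ + (c + 1) / s, hs0, hs1, hρ, hr, ?_⟩⟩
  rw [add_sub_cancel_left, mul_div_cancel₀ _ hs0.ne']
  exact lt_add_one c

theorem neg_div_le_quadratic {a : ℝ} (ha : 0 < a) (ρ t : ℝ) :
    -(ρ ^ 2 / a) ≤ a * t ^ 2 - 2 * ρ * t := by
  have hsq : a * (t - ρ / a) ^ 2 = a * t ^ 2 - 2 * ρ * t + ρ ^ 2 / a := by
    field_simp
    ring
  linarith [mul_nonneg ha.le (sq_nonneg (t - ρ / a))]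

theorem neg_le_sum_quadratic {a : ℝ} (ha : 0 < a) (ρ : ℝ) (t : Fin k → ℝ) :
    -(k * (ρ ^ 2 / a)) ≤ ∑ i, (a * t i ^ 2 - 2 * ρ * t i) := by
  simpa using Finset.sum_le_sum fun i (_ : i ∈ Finset.univ) => neg_div_le_quadratic ha ρ (t i)

theorem sum_quadratic_pos {a ρ : ℝ} {r : ℕ} (ha : 0 < a) (hρ : 0 ≤ ρ)
    (hr : k * (ρ ^ 2 / a) + 2 * ρ < a * r) {t : Fin k → ℝ} {i : Fin k} (hi : r ≤ t i) :
    0 < ∑ i, (a * t i ^ 2 - 2 * ρ * t i) := by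
  have hr1 : (1 : ℝ) ≤ r := by
    have : 0 < a * r := lt_of_le_of_lt (by positivity) hr
    exact_mod_cast Nat.cast_pos.1 (pos_of_mul_pos_right this ha.le)
  have hbig : k * (ρ ^ 2 / a) < a * t i ^ 2 - 2 * ρ * t i := by
    have hc : 0 ≤ k * (ρ ^ 2 / a) := by positivity
    have hslope : k * (ρ ^ 2 / a) < a * t i - 2 * ρ := by
      linarith [mul_le_mul_of_nonneg_left hi ha.le]
    nlinarith
  have hrest : -(k * (ρ ^ 2 / a)) ≤
      ∑ j ∈ Finset.univ.erase i, (a * t j ^ 2 - 2 * ρ * t j) := by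
    calc -(k * (ρ ^ 2 / a)) ≤ ∑ _j ∈ Finset.univ.erase i, -(ρ ^ 2 / a) := by
          rw [Finset.sum_const, Finset.card_erase_of_mem (Finset.mem_univ i), Finset.card_univ,
            Fintype.card_fin, nsmul_eq_mul, mul_neg, neg_le_neg_iff]
          gcongr
          exact Nat.sub_le k 1
      _ ≤ _ := Finset.sum_le_sum fun j _ => neg_div_le_quadratic ha ρ (t j)
  rw [← Finset.add_sum_erase _ _ (Finset.mem_univ i)]
  linarith

theorem mul_sqDist_sub_add_le_of_near_contraction {s ρ : ℝ} {u v : Fin k → ℝ} {n : Fin k → ℤ}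
    (hv : ∀ i, |v i - (n i + s * (u i - n i))| ≤ ρ) (m : Fin k → ℤ) :
    s * (sqDist u m - sqDist u n) +
        ∑ i, ((1 - s) * |(n i : ℝ) - m i| ^ 2 - 2 * ρ * |(n i : ℝ) - m i|) ≤
      sqDist v m - sqDist v n := by
  simp only [sqDist, ← Finset.sum_sub_distrib, Finset.mul_sum, ← Finset.sum_add_distrib]
  refine Finset.sum_le_sum fun i _ => ?_
  have herr : -(ρ * |(n i : ℝ) - m i|) ≤
      (v i - (n i + s * (u i - n i))) * ((n i : ℝ) - m i) := by
    refine (neg_le_neg ?_).trans (neg_abs_le _)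
    rw [abs_mul]
    exact mul_le_mul_of_nonneg_right (hv i) (abs_nonneg _)
  rw [sq_abs]
  nlinarith

theorem GoodWeights.strictlyOwns_of_near_contraction {h : (Fin k → ℤ) → ℝ} {M Λ s ρ : ℝ} {r : ℕ}
    (hg : GoodWeights h M Λ r) (hs : IsContractionScale k s ρ M Λ r) {u : Fin k → ℝ}
    {n : Fin k → ℤ} (hn : Owns h n u) {v : Fin k → ℝ}
    (hv : ∀ i, |v i - (n i + s * (u i - n i))| ≤ ρ) :
    StrictlyOwns (fun m => s * h m) n v := by
  intro m hm
  change sqDist v n + s * h n < sqDist v m + s * h m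
  have hs1 : 0 < 1 - s := sub_pos.2 hs.lt_one
  have hkey := mul_sqDist_sub_add_le_of_near_contraction hv m
  rcases (hg.le m).lt_or_eq with hmM | hmM
  · have hnM : h n < M := by
      have hΛM : 0 < M - Λ :=
        pos_of_mul_pos_right (lt_of_le_of_lt (by positivity) hs.lt_height) hs.pos.le
      linarith [hg.cost_le hn, sqDist_nonneg u n]
    obtain ⟨i, hi⟩ := hg.separated n m hnM hmM hm.symm
    have hsum := sum_quadratic_pos hs1 hs.nonneg hs.lt_separation
      (t := fun i => |(n i : ℝ) - m i|) (i := i) (by exact_mod_cast hi.le)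
    linarith [mul_le_mul_of_nonneg_left (hn m) hs.pos.le]
  · have hsum := neg_le_sum_quadratic hs1 ρ fun i => |(n i : ℝ) - m i|
    have hcost := mul_le_mul_of_nonneg_left (hg.cost_le hn) hs.pos.le
    have hdist := mul_nonneg hs.pos.le (sqDist_nonneg u m)
    rw [hmM]
    linarith [hs.lt_height]

/-- A single site strictly owns all lattice points within sup-distance `ℓ` of `z`. -/
def IsDeep (h : (Fin k → ℤ) → ℝ) (ℓ : ℕ) (z : Fin k → ℤ) : Prop :=
  ∃ n, ∀ v : Fin k → ℤ, (∀ i, |v i - z i| ≤ ℓ) → StrictlyOwns h n fun i => (v i : ℝ)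

section Rational

/-! The contraction factor is `s = p / (p + 1)`: it maps the point `w / p` with owner `n` to the
point `(w + n) / (p + 1)`, so that injectivity on lattice points can be counted. -/

variable {h : (Fin k → ℤ) → ℝ} {M ρ : ℝ} {Λ r p ℓ : ℕ}

theorem GoodWeights.strictlyOwns_near_div (hg : GoodWeights h M Λ r)
    (hs : IsContractionScale k (p / (p + 1)) ρ M Λ r) {w n : Fin k → ℤ}
    (hn : Owns h n fun i => (w i : ℝ) / p) {v : Fin k → ℝ}
    (hv : ∀ i, |v i - ((w i + n i : ℤ) : ℝ) / (p + 1)| ≤ ρ) :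
    StrictlyOwns (fun m => p / (p + 1) * h m) n v := by
  refine hg.strictlyOwns_of_near_contraction hs hn fun i => ?_
  have hp : (p : ℝ) ≠ 0 := fun hp => by simpa [hp] using hs.pos
  convert hv i using 3
  push_cast
  field_simp
  ring

theorem GoodWeights.eq_of_add_owner_eq (hg : GoodWeights h M Λ r)
    (hs : IsContractionScale k (p / (p + 1)) ρ M Λ r) {w w' n n' : Fin k → ℤ}
    (hn : Owns h n fun i => (w i : ℝ) / p) (hn' : Owns h n' fun i => (w' i : ℝ) / p)
    (heq : w + n = w' + n') : w = w' := by
  have howner : n = n' :=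
    (hg.strictlyOwns_near_div hs hn (v := fun i => ((w i + n i : ℤ) : ℝ) / (p + 1))
      fun i => by simpa using hs.nonneg).eq
    (hg.strictlyOwns_near_div hs hn' fun i => by
      rw [show w i + n i = w' i + n' i from congrFun heq i]
      simpa using hs.nonneg)
  exact add_right_cancel (howner ▸ heq)

theorem sub_one_lt_intCast_ediv (a : ℤ) (p : ℕ) :
    (a : ℝ) / (p + 1) - 1 < (a / ((p : ℤ) + 1) : ℤ) := by
  rw [sub_lt_iff_lt_add, div_lt_iff₀ (by positivity)]
  exact_mod_cast Int.lt_ediv_add_one_mul_self a (by positivity)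

theorem intCast_ediv_le (a : ℤ) (p : ℕ) : ((a / ((p : ℤ) + 1) : ℤ) : ℝ) ≤ a / (p + 1) := by
  rw [le_div_iff₀ (by positivity)]
  exact_mod_cast Int.ediv_mul_le a (by positivity)

theorem GoodWeights.isDeep_ediv (hg : GoodWeights h M Λ r)
    (hs : IsContractionScale k (p / (p + 1)) (ℓ + 1) M Λ r) {w n : Fin k → ℤ}
    (hn : Owns h n fun i => (w i : ℝ) / p) :
    IsDeep (fun m => p / (p + 1) * h m) ℓ fun i => (w i + n i) / ((p : ℤ) + 1) := by
  refine ⟨n, fun v hv => hg.strictlyOwns_near_div hs hn fun i => ?_⟩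
  have hvi : |(v i : ℝ) - ((w i + n i) / ((p : ℤ) + 1) : ℤ)| ≤ ℓ := by exact_mod_cast hv i
  rw [abs_le] at hvi ⊢
  constructor <;>
    linarith [hvi.1, hvi.2, sub_one_lt_intCast_ediv (w i + n i) p, intCast_ediv_le (w i + n i) p]

/-- The box `[-Λ, T + Λ]ᵏ` in `ℤᵏ`. -/
noncomputable def paddedBox (k T Λ : ℕ) : Finset (Fin k → ℤ) :=
  Fintype.piFinset fun _ => Finset.Icc (-(Λ : ℤ)) (T + Λ)

theorem card_paddedBox (k T Λ : ℕ) : #(paddedBox k T Λ) = (T + 2 * Λ + 1) ^ k := by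
  rw [paddedBox, Fintype.card_piFinset]
  simp only [Int.card_Icc, Finset.prod_const, Finset.card_univ, Fintype.card_fin]
  congr 1
  omega

theorem ediv_add_mem_Icc {T : ℕ} (hp : 0 < p) {w n : ℤ} (hw0 : 0 ≤ w) (hwT : w < (p * T : ℕ))
    (hwn : |(w : ℝ) / p - n| ≤ Λ) : (w + n) / ((p : ℤ) + 1) ∈ Finset.Icc (-(Λ : ℤ)) (T + Λ) := by
  have hp' : (0 : ℝ) < p := by exact_mod_cast hp
  have h0 : 0 ≤ (w : ℝ) / p := div_nonneg (by exact_mod_cast hw0) hp'.le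
  have hT : (w : ℝ) / p ≤ T := by
    rw [div_le_iff₀ hp', mul_comm]
    exact_mod_cast hwT.le
  have hmid : ((w + n : ℤ) : ℝ) / (p + 1) = w / p + (n - w / p) / (p + 1) := by
    push_cast
    field_simp
    ring
  have hshift : |(n - (w : ℝ) / p) / (p + 1)| ≤ Λ := by
    rw [abs_div, abs_of_pos (by positivity : (0 : ℝ) < p + 1), abs_sub_comm]
    exact (div_le_self (abs_nonneg _) (by linarith)).trans hwn
  rw [abs_le] at hshift
  have hlo : ((-Λ : ℤ) : ℝ) < ((w + n) / ((p : ℤ) + 1) : ℤ) + 1 := by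
    push_cast
    linarith [sub_one_lt_intCast_ediv (w + n) p]
  have hhi : (((w + n) / ((p : ℤ) + 1) : ℤ) : ℝ) ≤ (T + Λ : ℤ) := by
    push_cast
    linarith [intCast_ediv_le (w + n) p]
  exact Finset.mem_Icc.2 ⟨Int.lt_add_one_iff.1 (by exact_mod_cast hlo), by exact_mod_cast hhi⟩

theorem card_le_mul_card_image_ediv (S : Finset (Fin k → ℤ)) (p : ℕ) :
    #S ≤ (p + 1) ^ k * #(S.image fun y i => y i / ((p : ℤ) + 1)) := by
  refine Finset.card_le_mul_card_image _ _ fun z _ => ?_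
  calc #{y ∈ S | (fun i => y i / ((p : ℤ) + 1)) = z}
      ≤ #(Fintype.piFinset fun i =>
          Finset.Ico (((p : ℤ) + 1) * z i) (((p : ℤ) + 1) * z i + ((p : ℤ) + 1))) := by
        refine Finset.card_le_card fun y hy => Fintype.mem_piFinset.2 fun i => ?_
        have hpos : (0 : ℤ) < (p : ℤ) + 1 := by positivity
        rw [← (Finset.mem_filter.1 hy).2, Finset.mem_Ico]
        have := Int.mul_ediv_add_emod (y i) ((p : ℤ) + 1)
        have := Int.emod_nonneg (y i) hpos.ne'
        have := Int.emod_lt_of_pos (y i) hpos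
        constructor <;> linarith
    _ = (p + 1) ^ k := by
        rw [Fintype.card_piFinset]
        simp only [Int.card_Ico, add_sub_cancel_left, Finset.prod_const, Finset.card_univ,
          Fintype.card_fin]
        congr 1

open Classical in
theorem GoodWeights.pow_le_mul_card_isDeep (hg : GoodWeights h M Λ r) (hΛ : 0 < Λ)
    (hs : IsContractionScale k (p / (p + 1)) (ℓ + 1) M Λ r) (T : ℕ) :
    (p * T) ^ k ≤
      (p + 1) ^ k * #{z ∈ paddedBox k T Λ | IsDeep (fun m => p / (p + 1) * h m) ℓ z} := by
  have hp : 0 < p := Nat.pos_of_ne_zero fun hp => by simpa [hp] using hs.pos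
  choose N hN using fun w : Fin k → ℤ => exists_owns hg.nonneg fun i => (w i : ℝ) / p
  have hclose : ∀ w i, |(w i : ℝ) / p - N w i| ≤ Λ := fun w =>
    abs_sub_le_of_sqDist_le (by exact_mod_cast hΛ)
      ((le_add_of_nonneg_right (hg.nonneg _)).trans (hg.cost_le (hN w)))
  have hinj : Function.Injective fun w => w + N w := fun w w' =>
    hg.eq_of_add_owner_eq hs (hN w) (hN w')
  calc (p * T) ^ k = #((intBox k (p * T)).image fun w => w + N w) := by
        rw [Finset.card_image_of_injective _ hinj, card_intBox]
    _ ≤ _ := card_le_mul_card_image_ediv _ p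
    _ ≤ _ := by
        gcongr
        rw [Finset.image_image]
        refine Finset.image_subset_iff.2 fun w hw => Finset.mem_filter.2
          ⟨Fintype.mem_piFinset.2 fun i => ?_, hg.isDeep_ediv hs (hN w)⟩
        exact ediv_add_mem_Icc hp (mem_intBox.1 hw i).1 (mem_intBox.1 hw i).2 (hclose w i)

end Rational

end PowerDiagram

section Multiplicity

variable {X κ : Type*}

open Classical in
/-- The number of members of the family `(A k)`, `k ∈ I`, that contain `x`. -/
noncomputable def multiplicityAt (I : Finset κ) (A : κ → Set X) (x : X) : ℕ :=
  #{k ∈ I | x ∈ A k}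

theorem multiplicityAt_mono {Y : Type*} {I : Finset κ} {A : κ → Set X} {B : κ → Set Y} {x : X}
    {y : Y} (h : ∀ k ∈ I, x ∈ A k → y ∈ B k) : multiplicityAt I A x ≤ multiplicityAt I B y := by
  classical exact Finset.card_le_card (Finset.monotone_filter_right I h)

theorem multiplicityAt_pos {I : Finset κ} {A : κ → Set X} {x : X} :
    0 < multiplicityAt I A x ↔ ∃ k ∈ I, x ∈ A k := by
  simp [multiplicityAt, Finset.card_pos, Finset.filter_nonempty_iff]

theorem multiplicityAt_sigma {ι : Type*} (J : Finset ι) (K : ι → Finset κ) (A : ι → κ → Set X)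
    (x : X) : multiplicityAt (J.sigma K) (fun a => A a.1 a.2) x =
      ∑ j ∈ J, multiplicityAt (K j) (A j) x := by
  simp only [multiplicityAt, Finset.card_filter, Finset.sum_sigma]

theorem multiplicityAt_product {ι : Type*} (J : Finset ι) (K : Finset κ) (A : ι → κ → Set X)
    (x : X) : multiplicityAt (J ×ˢ K) (fun a => A a.1 a.2) x =
      ∑ j ∈ J, multiplicityAt K (A j) x := by
  simp only [multiplicityAt, Finset.card_filter, Finset.sum_product]

theorem natCast_multiplicityAt (I : Finset κ) (A : κ → Set X) (x : X) :
    (multiplicityAt I A x : ℝ) = ∑ k ∈ I, (A k).indicator (fun _ => 1) x := by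
  classical
  simp only [multiplicityAt, Finset.natCast_card_filter, Set.indicator_apply]

theorem integrable_multiplicityAt [MeasurableSpace X] {μ : Measure X} [IsFiniteMeasure μ]
    {I : Finset κ} {A : κ → Set X} (hA : ∀ k ∈ I, MeasurableSet (A k)) :
    Integrable (fun x => (multiplicityAt I A x : ℝ)) μ := by
  simp only [natCast_multiplicityAt]
  exact integrable_finsetSum _ fun k hk => (integrable_const _).indicator (hA k hk)

theorem integral_multiplicityAt [MeasurableSpace X] {μ : Measure X} [IsFiniteMeasure μ]
    {I : Finset κ} {A : κ → Set X} (hA : ∀ k ∈ I, MeasurableSet (A k)) :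
    ∫ x, (multiplicityAt I A x : ℝ) ∂μ = ∑ k ∈ I, μ.real (A k) := by
  simp only [natCast_multiplicityAt]
  rw [integral_finsetSum _ fun k hk => (integrable_const _).indicator (hA k hk)]
  exact Finset.sum_congr rfl fun k hk => by simp [integral_indicator_const _ (hA k hk)]

theorem ordAt_eq_multiplicityAt_sub_one (𝒱 : Finset (Set X)) (x : X) :
    ordAt 𝒱 x = multiplicityAt 𝒱 id x - 1 := by
  rw [ordAt, natCast_multiplicityAt]
  exact neg_add_eq_sub _ _

theorem ordAt_image_le [DecidableEq (Set X)] (I : Finset κ) (A : κ → Set X) (x : X) :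
    ordAt (I.image A) x ≤ multiplicityAt I A x - 1 := by
  classical
  rw [ordAt_eq_multiplicityAt_sub_one, multiplicityAt, Finset.filter_image]
  gcongr
  exact Finset.card_image_le

end Multiplicity

/-! ### The marker property implies the uniform Rokhlin property -/

section Marker

variable {Γ : Type*} [Group Γ]

theorem HasMarkerProperty.exists_continuousMap {X : Type*} [TopologicalSpace X] [CompactSpace X]
    [NormalSpace X] [MulAction Γ X] [ContinuousConstSMul Γ X] (h : HasMarkerProperty Γ X)
    (F : Finset Γ) :
    ∃ (φ : C(X, ℝ)) (A : Finset Γ), (∀ x, φ x ∈ Set.Icc (0 : ℝ) 1) ∧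
      (∀ γ ∈ F, ∀ x, 0 < φ x → 0 < φ (γ • x) → γ = 1) ∧ ∀ x, ∃ a ∈ A, φ (a • x) = 1 := by
  classical
  obtain ⟨U, hU, hdisj, hcov⟩ := h F
  obtain ⟨t, ht⟩ := isCompact_univ.elim_finite_subcover (fun γ : Γ => γ • U)
    (fun γ => hU.smul γ) hcov.ge
  obtain ⟨v, hv, hvc, hvU⟩ := exists_iUnion_eq_closed_subset (u := fun γ : t => (γ : Γ) • U)
    (fun γ => hU.smul _) (fun x => Set.toFinite _)
    (by simpa only [Set.iUnion_subtype] using Set.univ_subset_iff.1 ht)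
  have hclosed : IsClosed (⋃ γ : t, (γ : Γ)⁻¹ • v γ) :=
    isClosed_iUnion_of_finite fun γ => (hvc γ).smul _
  obtain ⟨φ, hφ0, hφ1, hφ⟩ := exists_continuous_zero_one_of_isClosed hU.isClosed_compl hclosed (by
    rw [Set.disjoint_compl_left_iff_subset]
    refine Set.iUnion_subset fun γ => ?_
    rw [Set.smul_set_subset_iff_subset_inv_smul_set, inv_inv]
    exact hvU γ)
  have hsupp : ∀ x, 0 < φ x → x ∈ U := fun x hx => by
    by_contra hxU
    exact hx.ne' (hφ0 hxU)
  refine ⟨φ, t⁻¹, hφ, fun γ hγ x hx hγx => ?_, fun x => ?_⟩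
  · by_contra hne
    exact Set.disjoint_left.1 (hdisj γ hγ hne) (hsupp _ hγx) (Set.smul_mem_smul_set (hsupp _ hx))
  · obtain ⟨γ, hγ⟩ := Set.mem_iUnion.1 (hv.ge (Set.mem_univ x))
    exact ⟨(γ : Γ)⁻¹, Finset.inv_mem_inv γ.2,
      hφ1 (Set.mem_iUnion.2 ⟨γ, Set.smul_mem_smul_set hγ⟩)⟩

theorem IsFactorMap.hasMarkerProperty {X Y : Type*} [TopologicalSpace X] [TopologicalSpace Y]
    [MulAction Γ X] [MulAction Γ Y] {π : X → Y} (hπ : IsFactorMap Γ π)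
    (hY : HasMarkerProperty Γ Y) : HasMarkerProperty Γ X := by
  obtain ⟨hcont, hequiv, -⟩ := hπ
  have hpre : ∀ (γ : Γ) (U : Set Y), γ • (π ⁻¹' U) = π ⁻¹' (γ • U) := by
    intro γ U
    ext x
    simp only [Set.mem_smul_set_iff_inv_smul_mem, Set.mem_preimage, hequiv]
  intro F
  obtain ⟨U, hU, hdisj, hcov⟩ := hY F
  refine ⟨π ⁻¹' U, hU.preimage hcont, fun γ hγ hne => ?_, ?_⟩
  · exact hpre γ U ▸ (hdisj γ hγ hne).preimage π
  · simp only [hpre, ← Set.preimage_iUnion, hcov, Set.preimage_univ]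

theorem exists_isOpen_disjoint_smul {Y : Type*} [TopologicalSpace Y] [T2Space Y] [MulAction Γ Y]
    [ContinuousConstSMul Γ Y] {γ : Γ} {y : Y} (hγ : γ • y ≠ y) :
    ∃ U : Set Y, IsOpen U ∧ y ∈ U ∧ Disjoint U (γ • U) := by
  obtain ⟨U, V, hU, hV, hyU, hyV, hUV⟩ := t2_separation hγ
  refine ⟨(γ • ·) ⁻¹' U ∩ V, (hU.preimage (continuous_const_smul γ)).inter hV, ⟨hyU, hyV⟩,
    Set.disjoint_left.2 ?_⟩
  rintro z ⟨-, hz⟩ ⟨w, ⟨hw, -⟩, rfl⟩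
  exact Set.disjoint_left.1 hUV hw hz

theorem hasMarkerProperty_of_isFreeAction_of_isMinimal {Y : Type*} [TopologicalSpace Y] [T2Space Y]
    [MulAction Γ Y] [ContinuousConstSMul Γ Y] (hfree : IsFreeAction Γ Y)
    (hmin : MulAction.IsMinimal Γ Y) : HasMarkerProperty Γ Y := by
  intro F
  rcases isEmpty_or_nonempty Y with hY | ⟨⟨y⟩⟩
  · exact ⟨∅, isOpen_empty, by simp, Subsingleton.elim _ _⟩
  have hsep : ∀ γ ∈ F, ∃ U : Set Y, IsOpen U ∧ y ∈ U ∧ (γ ≠ 1 → Disjoint U (γ • U)) := by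
    intro γ _
    by_cases hγ : γ = 1
    · exact ⟨Set.univ, isOpen_univ, Set.mem_univ _, fun h => absurd hγ h⟩
    · obtain ⟨U, hU, hyU, hdisj⟩ := exists_isOpen_disjoint_smul fun h => hγ (hfree γ y h)
      exact ⟨U, hU, hyU, fun _ => hdisj⟩
  choose! U hUo hyU hUd using hsep
  have hWo : IsOpen (⋂ γ ∈ F, U γ) := isOpen_biInter_finset hUo
  refine ⟨⋂ γ ∈ F, U γ, hWo, fun γ hγ hne => ?_, Set.eq_univ_of_forall fun x => ?_⟩
  · exact (hUd γ hγ hne).mono (Set.biInter_subset_of_mem hγ)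
      (Set.smul_set_mono (Set.biInter_subset_of_mem hγ))
  · obtain ⟨γ, hγ⟩ := hWo.exists_smul_mem Γ x ⟨y, Set.mem_iInter₂.2 hyU⟩
    exact Set.mem_iUnion.2 ⟨γ⁻¹, Set.mem_smul_set_iff_inv_smul_mem.2 (by rwa [inv_inv])⟩

end Marker

section OrbitWeights

variable {k : ℕ} {X : Type*} [MulAction (ZPow k) X]

/-- The weights on `ℤᵏ` along the orbit of `x`: the return times to `{φ = 1}` have weight `0`, the
times at which `φ` vanishes have weight `M`. -/
def orbitWeights (φ : X → ℝ) (M : ℝ) (x : X) (n : Fin k → ℤ) : ℝ :=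
  M * (1 - φ (Multiplicative.ofAdd n • x))

theorem orbitWeights_smul (φ : X → ℝ) (M : ℝ) (z : ZPow k) (x : X) (n : Fin k → ℤ) :
    orbitWeights φ M (z • x) n = orbitWeights φ M x (n + z.toAdd) := by
  simp only [orbitWeights, smul_smul, ofAdd_add, ofAdd_toAdd]

theorem continuous_orbitWeights [TopologicalSpace X] [ContinuousConstSMul (ZPow k) X]
    (φ : C(X, ℝ)) (M : ℝ) (n : Fin k → ℤ) : Continuous fun x => orbitWeights φ M x n := by
  unfold orbitWeights
  fun_prop

theorem sqDist_add_floor_le (u : Fin k → ℝ) (a : Fin k → ℤ) :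
    sqDist u (a + fun i => ⌊u i⌋) ≤ ∑ i, (1 + |(a i : ℝ)|) ^ 2 := by
  refine Finset.sum_le_sum fun i _ => sq_le_sq' ?_ ?_ <;>
    push_cast [Pi.add_apply] <;>
    linarith [Int.floor_le (u i), Int.lt_floor_add_one (u i), neg_abs_le (a i : ℝ),
      le_abs_self (a i : ℝ)]

theorem goodWeights_orbitWeights {φ : X → ℝ} {M Λ : ℝ} {r : ℕ}
    (hφ : ∀ x, φ x ∈ Set.Icc (0 : ℝ) 1) (hM : 0 ≤ M)
    (hsep : ∀ γ : ZPow k, (∀ i, |γ.toAdd i| ≤ r) → ∀ x, 0 < φ x → 0 < φ (γ • x) → γ = 1)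
    {A : Finset (ZPow k)} (hA : ∀ x, ∃ a ∈ A, φ (a • x) = 1)
    (hΛ : ∀ a ∈ A, ∑ i, (1 + |(a.toAdd i : ℝ)|) ^ 2 ≤ Λ) (x : X) :
    GoodWeights (orbitWeights (k := k) φ M x) M Λ r where
  nonneg n := mul_nonneg hM (sub_nonneg.2 (hφ _).2)
  le n := mul_le_of_le_one_right hM (sub_le_self 1 (hφ _).1)
  separated n m hn hm hne := by
    have hpos : ∀ n : Fin k → ℤ, orbitWeights φ M x n < M → 0 < φ (Multiplicative.ofAdd n • x) :=
      fun n hn => (hφ _).1.lt_of_ne fun h => by simp [orbitWeights, ← h] at hn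
    by_contra! hcon
    have hone := hsep (Multiplicative.ofAdd (n - m)) (fun i => by simpa using hcon i)
      (Multiplicative.ofAdd m • x) (hpos m hm)
      (by rw [smul_smul, ← ofAdd_add, sub_add_cancel]; exact hpos n hn)
    exact hne (sub_eq_zero.1 (Multiplicative.ofAdd.injective hone))
  dense u := by
    obtain ⟨a, ha, hφa⟩ := hA (Multiplicative.ofAdd (fun i => ⌊u i⌋) • x)
    refine ⟨a.toAdd + fun i => ⌊u i⌋, ?_, (sqDist_add_floor_le u _).trans (hΛ a ha)⟩
    rw [smul_smul] at hφa
    simp [orbitWeights, ofAdd_add, hφa]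

theorem HasMarkerProperty.exists_goodWeights [TopologicalSpace X] [CompactSpace X] [NormalSpace X]
    [ContinuousConstSMul (ZPow k) X] (hX : HasMarkerProperty (ZPow k) X) (r : ℕ) :
    ∃ (φ : C(X, ℝ)) (Λ : ℕ), 0 < Λ ∧
      ∀ M, 0 ≤ M → ∀ x, GoodWeights (orbitWeights (k := k) φ M x) M Λ r := by
  obtain ⟨φ, A, hφ, hsep, hA⟩ := hX.exists_continuousMap
    ((Fintype.piFinset fun _ : Fin k => Finset.Icc (-(r : ℤ)) r).map
      Multiplicative.ofAdd.toEmbedding)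
  obtain ⟨Λ, hΛ⟩ := exists_nat_gt (∑ a ∈ A, ∑ i, (1 + |(a.toAdd i : ℝ)|) ^ 2)
  have hterm : ∀ a ∈ A, 0 ≤ ∑ i, (1 + |(a.toAdd i : ℝ)|) ^ 2 := fun a _ => by positivity
  refine ⟨φ, Λ, ?_, fun M hM => goodWeights_orbitWeights hφ hM (fun γ hγ => hsep γ ?_) hA
    fun a ha => (Finset.single_le_sum hterm ha).trans hΛ.le⟩
  · exact_mod_cast (Finset.sum_nonneg hterm).trans_lt hΛ
  · rw [Finset.mem_map_equiv, Fintype.mem_piFinset]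
    exact fun i => Finset.mem_Icc.2 (abs_le.1 (hγ i))

end OrbitWeights

section Tower

variable {k : ℕ} {X : Type*} {H : X → (Fin k → ℤ) → ℝ} {ℓ : ℕ}

/-- The base of the Rokhlin tower with shape `box k ℓ` for the weights `H`: a site in `ℓℤᵏ` strictly
owns the whole box. -/
def towerBase (H : X → (Fin k → ℤ) → ℝ) (ℓ : ℕ) : Set X :=
  {x | ∃ n : Fin k → ℤ, (∀ i, (ℓ : ℤ) ∣ n i) ∧
    ∀ v ∈ intBox k ℓ, StrictlyOwns (H x) n fun i => (v i : ℝ)}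

theorem isOpen_towerBase [TopologicalSpace X] {M : ℝ} (hcont : ∀ m, Continuous fun x => H x m)
    (hH0 : ∀ x m, 0 ≤ H x m) (hHM : ∀ x m, H x m ≤ M) (ℓ : ℕ) : IsOpen (towerBase H ℓ) := by
  have hunion : towerBase H ℓ = ⋃ n : Fin k → ℤ, ⋃ _ : ∀ i, (ℓ : ℤ) ∣ n i,
      ⋂ v ∈ intBox k ℓ, {x : X | StrictlyOwns (H x) n fun i => (v i : ℝ)} := by
    ext x
    simp [towerBase]
  rw [hunion]
  exact isOpen_iUnion fun n => isOpen_iUnion fun _ =>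
    isOpen_biInter_finset fun v _ => isOpen_setOf_strictlyOwns hcont hH0 hHM n _

variable [MulAction (ZPow k) X]

theorem strictlyOwns_of_mem_smul_towerBase
    (hH : ∀ (z : ZPow k) x n, H (z • x) n = H x (n + z.toAdd))
    {γ : ZPow k} (hγ : γ ∈ box k ℓ) {x : X} (hx : x ∈ γ • towerBase H ℓ) :
    ∃ n : Fin k → ℤ, (∀ i, (ℓ : ℤ) ∣ n i + γ.toAdd i) ∧ StrictlyOwns (H x) n 0 := by
  obtain ⟨y, ⟨n, hn, hown⟩, rfl⟩ := hx
  refine ⟨n - γ.toAdd, fun i => by simpa using hn i, ?_⟩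
  have heq : H (γ • y) = fun m => H y (m + γ.toAdd) := funext (hH γ y)
  simpa [heq, strictlyOwns_shift] using hown _ (mem_box.1 hγ)

theorem disjoint_smul_towerBase (hH : ∀ (z : ZPow k) x n, H (z • x) n = H x (n + z.toAdd))
    {γ δ : ZPow k} (hγ : γ ∈ box k ℓ) (hδ : δ ∈ box k ℓ) (hne : γ ≠ δ) :
    Disjoint (γ • towerBase H ℓ) (δ • towerBase H ℓ) := by
  rw [Set.disjoint_left]
  intro x hx hx'
  obtain ⟨n, hn, hown⟩ := strictlyOwns_of_mem_smul_towerBase hH hγ hx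
  obtain ⟨m, hm, hown'⟩ := strictlyOwns_of_mem_smul_towerBase hH hδ hx'
  obtain rfl := hown.eq hown'
  refine hne (Multiplicative.toAdd.injective (funext fun i => ?_))
  have hdvd : (ℓ : ℤ) ∣ γ.toAdd i - δ.toAdd i := by simpa using dvd_sub (hn i) (hm i)
  have hγi := mem_intBox.1 (mem_box.1 hγ) i
  have hδi := mem_intBox.1 (mem_box.1 hδ) i
  linarith [Int.eq_zero_of_abs_lt_dvd hdvd (by rw [abs_lt]; constructor <;> linarith)]

theorem smul_mem_tower_of_isDeep (hH : ∀ (z : ZPow k) x n, H (z • x) n = H x (n + z.toAdd))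
    (hℓ : 0 < ℓ) {x : X} {z : Fin k → ℤ} (hz : IsDeep (H x) ℓ z) :
    Multiplicative.ofAdd z • x ∈ ⋃ γ ∈ box k ℓ, γ • towerBase H ℓ := by
  obtain ⟨n, hn⟩ := hz
  have hℓ' : (0 : ℤ) < ℓ := by exact_mod_cast hℓ
  set g : Fin k → ℤ := fun i => (z i - n i) % ℓ
  have hgbox : g ∈ intBox k ℓ :=
    mem_intBox.2 fun i => ⟨Int.emod_nonneg _ hℓ'.ne', Int.emod_lt_of_pos _ hℓ'⟩
  refine Set.mem_biUnion (x := Multiplicative.ofAdd g) (mem_box.2 hgbox) ?_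
  rw [Set.mem_smul_set_iff_inv_smul_mem, ← ofAdd_neg, smul_smul, ← ofAdd_add]
  have heq : H (Multiplicative.ofAdd (-g + z) • x) = fun m => H x (m + (-g + z)) := funext (hH _ x)
  refine ⟨n - (-g + z), fun i => ?_, fun v hv => ?_⟩
  · have hdvd : (ℓ : ℤ) ∣ g i - (z i - n i) := Int.dvd_sub_self_of_emod_eq rfl
    convert hdvd using 1
    simp only [Pi.sub_apply, Pi.add_apply, Pi.neg_apply]
    ring
  · have hnear : ∀ i, |(v + (-g + z)) i - z i| ≤ ℓ := fun i => by
      have hvi := mem_intBox.1 hv i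
      have hgi := mem_intBox.1 hgbox i
      simp only [Pi.add_apply, Pi.neg_apply]
      rw [abs_le]
      constructor <;> linarith
    rw [heq, strictlyOwns_shift, sub_add_cancel]
    convert hn _ hnear using 2
    simp

end Tower

theorem le_card_mul_measureReal_of_forall_le_multiplicityAt {Γ X ι : Type*} [Group Γ]
    [MulAction Γ X] [MeasurableSpace X] [MeasurableConstSMul Γ X] {μ : Measure X}
    [IsProbabilityMeasure μ] [SMulInvariantMeasure Γ X μ] {E : Set X} (hE : MeasurableSet E) {c : ℝ}
    (B : Finset ι) (g : ι → Γ) (hc : ∀ x, c ≤ multiplicityAt B (fun i => (g i • ·) ⁻¹' E) x) :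
    c ≤ #B * μ.real E := by
  have hmeas : ∀ i ∈ B, MeasurableSet ((g i • ·) ⁻¹' E) := fun i _ => measurable_const_smul (g i) hE
  calc c = ∫ _x, c ∂μ := by simp
    _ ≤ ∫ x, (multiplicityAt B (fun i => (g i • ·) ⁻¹' E) x : ℝ) ∂μ :=
        integral_mono (integrable_const _) (integrable_multiplicityAt hmeas) hc
    _ = ∑ _i ∈ B, μ.real E := by
        rw [integral_multiplicityAt hmeas]
        exact Finset.sum_congr rfl fun i _ => by
          rw [measureReal_def, measure_preimage_smul, measureReal_def]
    _ = #B * μ.real E := by rw [Finset.sum_const, nsmul_eq_mul]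

theorem pow_div_add_le_measureReal_of_visits {k : ℕ} {X : Type*} [MeasurableSpace X]
    [MulAction (ZPow k) X] [MeasurableConstSMul (ZPow k) X] {μ : Measure X}
    [IsProbabilityMeasure μ] [SMulInvariantMeasure (ZPow k) X μ] {E : Set X}
    (hE : MeasurableSet E) {p Λ : ℕ}
    (hvisits : ∀ (T : ℕ) (x : X), (p * T) ^ k ≤ (p + 1) ^ k *
      multiplicityAt (paddedBox k T Λ) (fun z => (Multiplicative.ofAdd z • ·) ⁻¹' E) x) :
    ((p : ℝ) / (p + 1)) ^ k ≤ μ.real E := by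
  have hlim : Tendsto (fun T : ℕ => ((p : ℝ) / (p + 1)) ^ k * ((T : ℝ) / (T + (2 * Λ + 1))) ^ k)
      atTop (𝓝 (((p : ℝ) / (p + 1)) ^ k * 1 ^ k)) :=
    ((tendsto_natCast_div_add_atTop (2 * (Λ : ℝ) + 1)).pow k).const_mul _
  rw [one_pow, mul_one] at hlim
  refine le_of_tendsto hlim (Eventually.of_forall fun T => ?_)
  have hmass := le_card_mul_measureReal_of_forall_le_multiplicityAt (μ := μ) hE
    (c := (p * T : ℝ) ^ k / (p + 1) ^ k) (paddedBox k T Λ) Multiplicative.ofAdd fun x => by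
      rw [div_le_iff₀' (by positivity)]
      exact_mod_cast hvisits T x
  rw [card_paddedBox, div_le_iff₀ (by positivity)] at hmass
  rw [div_pow, div_pow, div_mul_div_comm, div_le_iff₀ (by positivity), ← mul_pow]
  refine hmass.trans_eq ?_
  push_cast
  ring

theorem hasURP_of_hasMarkerProperty {k : ℕ} {X : Type*} [TopologicalSpace X] [CompactSpace X]
    [NormalSpace X] [MeasurableSpace X] [BorelSpace X] [MulAction (ZPow k) X]
    [ContinuousConstSMul (ZPow k) X] (hX : HasMarkerProperty (ZPow k) X) : HasURP (ZPow k) X := by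
  classical
  intro K ε hε
  obtain ⟨ℓ, hℓ, hinv⟩ := exists_isInvariantSet_box k K hε
  obtain ⟨p, hp, hpε⟩ : ∃ p : ℕ, 0 < p ∧ 1 - ((p : ℝ) / (p + 1)) ^ k < ε := by
    have hlim : Tendsto (fun p : ℕ => 1 - ((p : ℝ) / (p + 1)) ^ k) atTop (𝓝 (1 - 1 ^ k)) :=
      ((tendsto_natCast_div_add_atTop (1 : ℝ)).pow k).const_sub 1
    rw [one_pow, sub_self] at hlim
    exact ((eventually_gt_atTop 0).and (hlim.eventually_lt_const hε)).exists
  have hs1 : (p : ℝ) / (p + 1) < 1 := (div_lt_one (by positivity)).2 (lt_add_one _)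
  obtain ⟨r, hr⟩ := exists_isContractionScale k (s := p / (p + 1)) (ρ := ℓ + 1) (by positivity) hs1
    (by positivity)
  obtain ⟨φ, Λ, hΛ, hgood⟩ := hX.exists_goodWeights r
  obtain ⟨M, hM⟩ := hr Λ
  replace hgood := hgood M hM.height_nonneg
  set H : X → (Fin k → ℤ) → ℝ := fun x m => p / (p + 1) * orbitWeights φ M x m with hH
  have hHsmul : ∀ (z : ZPow k) x n, H (z • x) n = H x (n + z.toAdd) := fun z x n => by
    simp only [hH, orbitWeights_smul]
  have hVo : IsOpen (towerBase H ℓ) :=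
    isOpen_towerBase (fun m => (continuous_orbitWeights φ M m).const_mul _)
      (fun x m => mul_nonneg hM.pos.le ((hgood x).nonneg m))
      (fun x m => mul_le_mul_of_nonneg_left ((hgood x).le m) hM.pos.le) ℓ
  have hE : IsOpen (⋃ γ ∈ box k ℓ, γ • towerBase H ℓ) := isOpen_biUnion fun γ _ => hVo.smul γ
  refine ⟨1, fun _ => towerBase H ℓ, fun _ => box k ℓ, fun _ => hVo, fun _ => hinv, ?_, ?_⟩
  · intro i γ hγ j δ hδ hne
    exact disjoint_smul_towerBase hHsmul hγ hδ fun h => hne (by rw [h, Subsingleton.elim i j])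
  · rw [Set.iUnion_const]
    refine (iSup₂_le fun μ ⟨_, _⟩ => ?_).trans_lt ((ENNReal.ofReal_lt_ofReal_iff hε).2 hpε)
    have hmass := pow_div_add_le_measureReal_of_visits (μ := μ) hE.measurableSet fun T x =>
      ((hgood x).pow_le_mul_card_isDeep hΛ hM T).trans <| Nat.mul_le_mul_left _ <|
        Finset.card_le_card <| Finset.monotone_filter_right _ fun z _ hz =>
          smul_mem_tower_of_isDeep hHsmul hℓ hz
    rw [← ofReal_measureReal (measure_ne_top μ _), probReal_compl_eq_one_sub hE.measurableSet]
    exact ENNReal.ofReal_le_ofReal (by linarith)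

/-! ### Open covers -/

section Cover

variable {X : Type*} [TopologicalSpace X]

theorem IsOpenCover.exists_mem {𝒱 : Finset (Set X)} (h : IsOpenCover 𝒱) (x : X) :
    ∃ V ∈ 𝒱, x ∈ V := by
  simpa using h.2.ge (Set.mem_univ x)

theorem isOpenCover_of_forall_exists_mem {𝒱 : Finset (Set X)} (hopen : ∀ V ∈ 𝒱, IsOpen V)
    (hcov : ∀ x, ∃ V ∈ 𝒱, x ∈ V) : IsOpenCover 𝒱 :=
  ⟨hopen, Set.eq_univ_of_forall fun x => by simpa using hcov x⟩

theorem IsOpenCover.exists_subordinate [NormalSpace X] {𝒱 : Finset (Set X)} (h : IsOpenCover 𝒱) :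
    ∃ ρ : Set X → X → ℝ≥0, (∀ V, Continuous (ρ V)) ∧ (∀ V ∈ 𝒱, tsupport (ρ V) ⊆ V) ∧
      ∀ x, ∃ V ∈ 𝒱, ρ V x ≠ 0 := by
  classical
  obtain ⟨f, hf⟩ := PartitionOfUnity.exists_isSubordinate_of_locallyFinite isClosed_univ
    (fun V : 𝒱 => (V : Set X)) (fun V => h.1 V V.2) (locallyFinite_of_finite _) (fun x _ => by
      obtain ⟨V, hV, hx⟩ := h.exists_mem x
      exact Set.mem_iUnion.2 ⟨⟨V, hV⟩, hx⟩)
  refine ⟨fun V x => if hV : V ∈ 𝒱 then (f ⟨V, hV⟩ x).toNNReal else 0, fun V => ?_, fun V hV => ?_,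
    fun x => ?_⟩
  · by_cases hV : V ∈ 𝒱 <;> simp only [hV, dite_true, dite_false]
    · exact continuous_real_toNNReal.comp (f ⟨V, hV⟩).continuous
    · exact continuous_const
  · refine (closure_mono <| Function.support_subset_iff'.2 fun x hx => ?_).trans (hf ⟨V, hV⟩)
    simp only [dif_pos hV, Function.notMem_support.1 hx, Real.toNNReal_zero]
  · obtain ⟨V, hV⟩ := f.exists_pos (Set.mem_univ x)
    exact ⟨V, V.2, by simpa using hV⟩

end Cover

section DominanceCell

variable {X α : Type*} {r : α → X → ℝ≥0} {I A B : Finset α} {x : X}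

/-- The points at which the coordinates in `A` are positive and exceed all other coordinates in `I`.
When the `r a` are barycentric coordinates, this is the open star of the barycenter of the face `A`
in the barycentric subdivision. -/
def dominanceCell (r : α → X → ℝ≥0) (I A : Finset α) : Set X :=
  {x | (∀ a ∈ A, r a x ≠ 0) ∧ ∀ a ∈ A, ∀ b ∈ I, b ∉ A → r b x < r a x}

theorem isOpen_dominanceCell [TopologicalSpace X] (hr : ∀ a ∈ I, Continuous (r a)) (hA : A ⊆ I) :
    IsOpen (dominanceCell r I A) := by
  simp only [dominanceCell, Set.ofPred_and, Set.ofPred_forall]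
  refine (isOpen_biInter_finset fun a ha => ?_).inter <| isOpen_biInter_finset fun a ha =>
    isOpen_biInter_finset fun b hb => isOpen_iInter_of_finite fun _ => ?_
  · exact isOpen_ne_fun (hr a (hA ha)) continuous_const
  · exact isOpen_lt (hr b hb) (hr a (hA ha))

theorem eq_of_mem_dominanceCell (hA : A ⊆ I) (hB : B ⊆ I) (hxA : x ∈ dominanceCell r I A)
    (hxB : x ∈ dominanceCell r I B) (hcard : #A = #B) : A = B := by
  refine Finset.eq_of_subset_of_card_le (fun a ha => ?_) hcard.ge
  by_contra haB
  obtain ⟨b, hb, hbA⟩ : ∃ b ∈ B, b ∉ A := by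
    by_contra! hBA
    exact haB (Finset.eq_of_subset_of_card_le hBA hcard.le ▸ ha)
  exact lt_asymm (hxA.2 a ha b (hB hb) hbA) (hxB.2 b hb a (hA ha) haB)

theorem multiplicityAt_dominanceCell_add_le {P : Finset (Finset α)} {m : ℕ} (hP : ∀ A ∈ P, A ⊆ I)
    (hPm : ∀ A ∈ P, m ≤ #A) (hm : m ≤ multiplicityAt I (fun a => (r a).support) x) :
    multiplicityAt P (dominanceCell r I) x + m ≤
      multiplicityAt I (fun a => (r a).support) x + 1 := by
  classical
  suffices multiplicityAt P (dominanceCell r I) x ≤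
      #(Finset.Icc m (multiplicityAt I (fun a => (r a).support) x)) by
    rw [Nat.card_Icc] at this
    lia
  refine Finset.card_le_card_of_injOn Finset.card (fun A hA => ?_) fun A hA B hB => ?_
  · obtain ⟨hAP, hxA⟩ := Finset.mem_filter.1 hA
    exact Finset.mem_coe.2 <| Finset.mem_Icc.2 ⟨hPm A hAP, Finset.card_le_card fun a ha =>
      Finset.mem_filter.2 ⟨hP A hAP ha, hxA.1 a ha⟩⟩
  · obtain ⟨hAP, hxA⟩ := Finset.mem_filter.1 hA
    obtain ⟨hBP, hxB⟩ := Finset.mem_filter.1 hB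
    exact eq_of_mem_dominanceCell (hP A hAP) (hP B hBP) hxA hxB

end DominanceCell

section SupRatio

variable {X κ : Type*} {K : Finset κ} {f : κ → X → ℝ≥0} {k : κ} {x : X}

/-- The family `f` normalized to have maximum `1` over `K` at every point where it does not vanish
identically. -/
noncomputable def supRatio (K : Finset κ) (f : κ → X → ℝ≥0) (k : κ) (x : X) : ℝ≥0 :=
  f k x / K.sup (f · x)

theorem le_sup_apply (hk : k ∈ K) : f k x ≤ K.sup (f · x) :=
  Finset.le_sup (f := (f · x)) hk

theorem continuous_supRatio [TopologicalSpace X] (hf : ∀ k, Continuous (f k))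
    (hcov : ∀ x, ∃ k ∈ K, f k x ≠ 0) : Continuous (supRatio K f k) := by
  refine (hf k).div₀ (Continuous.finset_sup_apply fun k _ => hf k) fun x hx => ?_
  obtain ⟨k, hk, hfk⟩ := hcov x
  exact hfk (le_zero_iff.1 ((le_sup_apply hk).trans_eq hx))

theorem supRatio_le_one (hk : k ∈ K) : supRatio K f k x ≤ 1 :=
  div_le_one_of_le₀ (le_sup_apply hk) zero_le

theorem support_supRatio (hk : k ∈ K) : (supRatio K f k).support = (f k).support := by
  ext x
  refine div_ne_zero_iff.trans (and_iff_left_of_imp fun hfk hsup => hfk ?_)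
  exact le_zero_iff.1 ((le_sup_apply hk).trans_eq hsup)

theorem exists_supRatio_eq_one (hcov : ∃ k ∈ K, f k x ≠ 0) : ∃ k ∈ K, supRatio K f k x = 1 := by
  obtain ⟨k₀, hk₀, hne⟩ := hcov
  obtain ⟨k, hk, hsup⟩ := Finset.exists_mem_eq_sup K ⟨k₀, hk₀⟩ (f · x)
  refine ⟨k, hk, ?_⟩
  rw [supRatio, ← hsup]
  exact div_self fun h => hne (le_zero_iff.1 ((le_sup_apply hk₀).trans_eq h))

end SupRatio

section JointCover

variable {X ι κ : Type*} [TopologicalSpace X]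

theorem exists_openCover_ordAt_le_sum {J : Finset ι} {K : ι → Finset κ}
    {f : ι → κ → X → ℝ≥0} (hf : ∀ j k, Continuous (f j k))
    (hcov : ∀ j ∈ J, ∀ x, ∃ k ∈ K j, f j k x ≠ 0) :
    ∃ 𝒲 : Finset (Set X), IsOpenCover 𝒲 ∧
      (∀ W ∈ 𝒲, ∀ j ∈ J, ∃ k ∈ K j, W ⊆ (f j k).support) ∧
      ∀ x, ordAt 𝒲 x ≤ ∑ j ∈ J, ((multiplicityAt (K j) (fun k => (f j k).support) x : ℝ) - 1) := by
  classical
  set I : Finset (Σ _ : ι, κ) := J.sigma K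
  set r : (Σ _ : ι, κ) → X → ℝ≥0 := fun a => supRatio (K a.1) (f a.1) a.2
  have hsupp : ∀ a ∈ I, (r a).support = (f a.1 a.2).support := fun a ha =>
    support_supRatio (Finset.mem_sigma.1 ha).2
  set P : Finset (Finset (Σ _ : ι, κ)) := {A ∈ I.powerset | J ⊆ A.image Sigma.fst}
  have hP : ∀ {A}, A ∈ P ↔ A ⊆ I ∧ J ⊆ A.image Sigma.fst := by
    simp only [P, Finset.mem_filter, Finset.mem_powerset, implies_true]
  refine ⟨P.image (dominanceCell r I), isOpenCover_of_forall_exists_mem ?_ fun x => ?_, ?_,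
    fun x => (ordAt_image_le _ _ _).trans ?_⟩
  · refine Finset.forall_mem_image.2 fun A hA => isOpen_dominanceCell (fun a ha => ?_) (hP.1 hA).1
    exact continuous_supRatio (hf a.1) (hcov a.1 (Finset.mem_sigma.1 ha).1)
  · refine ⟨_, Finset.mem_image_of_mem _
      (hP.2 ⟨I.filter_subset fun a => r a x = 1, fun j hj => ?_⟩), fun a ha => ?_,
      fun a ha b hb hbA => ?_⟩
    · obtain ⟨k, hk, hrk⟩ := exists_supRatio_eq_one (hcov j hj x)
      exact Finset.mem_image.2
        ⟨⟨j, k⟩, Finset.mem_filter.2 ⟨Finset.mem_sigma.2 ⟨hj, hk⟩, hrk⟩, rfl⟩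
    · exact (Finset.mem_filter.1 ha).2 ▸ one_ne_zero
    · rw [(Finset.mem_filter.1 ha).2]
      exact (supRatio_le_one (Finset.mem_sigma.1 hb).2).lt_of_ne fun h =>
        hbA (Finset.mem_filter.2 ⟨hb, h⟩)
  · refine Finset.forall_mem_image.2 fun A hA j hj => ?_
    obtain ⟨a, ha, rfl⟩ := Finset.mem_image.1 ((hP.1 hA).2 hj)
    have haI := (hP.1 hA).1 ha
    exact ⟨a.2, (Finset.mem_sigma.1 haI).2, fun x hx => hsupp a haI ▸ hx.1 a ha⟩
  · have hcount : multiplicityAt I (fun a => (r a).support) x =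
        ∑ j ∈ J, multiplicityAt (K j) (fun k => (f j k).support) x := by
      rw [← multiplicityAt_sigma]
      exact le_antisymm (multiplicityAt_mono fun a ha hx => hsupp a ha ▸ hx)
        (multiplicityAt_mono fun a ha hx => (hsupp a ha).symm ▸ hx)
    have hJ : #J ≤ multiplicityAt I (fun a => (r a).support) x := by
      rw [hcount, Finset.card_eq_sum_ones]
      exact Finset.sum_le_sum fun j hj => multiplicityAt_pos.2 (hcov j hj x)
    have hbound := multiplicityAt_dominanceCell_add_le (r := r) (fun A hA => (hP.1 hA).1)
      (fun A hA => (Finset.card_le_card (hP.1 hA).2).trans Finset.card_image_le) hJ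
    rw [hcount] at hbound
    rw [Finset.sum_sub_distrib, Finset.sum_const, nsmul_one, sub_le_sub_iff]
    exact_mod_cast hbound

end JointCover

section GenericWeights

/-- The linear map which sends potentials on the two sides of a bipartite graph to their differences
along the edges; the edge `e` joins `s e` to `t e`. -/
def potentialDiff {α β ε : Type*} (s : ε → α) (t : ε → β) :
    ((α → ℝ) × (β → ℝ)) →ₗ[ℝ] (ε → ℝ) :=
  (LinearMap.funLeft ℝ ℝ s).coprod (-LinearMap.funLeft ℝ ℝ t)

theorem potentialDiff_apply {α β ε : Type*} (s : ε → α) (t : ε → β) (z : α → ℝ) (y : β → ℝ)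
    (e : ε) : potentialDiff s t (z, y) e = z (s e) - y (t e) := by
  simp [potentialDiff, LinearMap.funLeft_apply, sub_eq_add_neg]

theorem range_potentialDiff_ne_top_of_card_le {α β ε : Type*} [Fintype α] [Fintype β] [Fintype ε]
    [Nonempty β] (s : ε → α) (t : ε → β)
    (hcard : Fintype.card α + Fintype.card β ≤ Fintype.card ε) :
    LinearMap.range (potentialDiff s t) ≠ ⊤ := by
  intro htop
  have hrank := LinearMap.finrank_range_add_finrank_ker (potentialDiff s t)
  rw [htop, finrank_top, Module.finrank_prod, Module.finrank_fintype_fun_eq_card,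
    Module.finrank_fintype_fun_eq_card, Module.finrank_fintype_fun_eq_card] at hrank
  have hconst : ((fun _ => 1, fun _ => 1) : (α → ℝ) × (β → ℝ)) ∈
      LinearMap.ker (potentialDiff s t) :=
    LinearMap.mem_ker.2 (funext fun e => by simp [potentialDiff_apply])
  have hker : 0 < Module.finrank ℝ (LinearMap.ker (potentialDiff s t)) := by
    refine Module.finrank_pos_iff_exists_ne_zero.2 ⟨⟨_, hconst⟩, fun h => ?_⟩
    have hone := congrArg (fun p => p.1.2 (Classical.arbitrary β)) h
    simp at hone
  lia

theorem range_potentialDiff_ne_top {α β : Type*} {N : Finset α} {S : Finset β}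
    {E : Finset (α × β)} (hE : E ⊆ N ×ˢ S) (hS : S.Nonempty) (hcard : #N + #S ≤ #E) :
    LinearMap.range (potentialDiff (fun e : E => e.1.1) fun e : E => e.1.2) ≠ ⊤ := by
  have := hS.to_subtype
  refine ne_top_of_le_ne_top (range_potentialDiff_ne_top_of_card_le (ε := E)
    (fun e => (⟨e.1.1, (Finset.mem_product.1 (hE e.2)).1⟩ : N))
    (fun e => (⟨e.1.2, (Finset.mem_product.1 (hE e.2)).2⟩ : S)) ?_) ?_
  · simpa only [Fintype.card_coe] using hcard
  · rintro _ ⟨p, rfl⟩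
    exact ⟨(fun n => p.1 n, fun w => p.2 w), rfl⟩

theorem exists_forall_restrict_notMem {ε : Type*} (𝓔 : Finset (Finset ε))
    {L : ∀ E : Finset ε, Submodule ℝ (E → ℝ)} (hL : ∀ E ∈ 𝓔, L E ≠ ⊤) :
    ∃ b : ε → ℝ, ∀ E ∈ 𝓔, (fun e : E => b e) ∉ L E := by
  classical
  set q : Finset ε → Submodule ℝ (ε → ℝ) := fun E =>
    (L E).comap (LinearMap.funLeft ℝ ℝ (Subtype.val : E → ε))
  have hq : ∀ E ∈ 𝓔, q E ≠ ⊤ := by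
    intro E hE htop
    refine hL E hE (eq_top_iff.2 fun g _ => ?_)
    obtain ⟨b, rfl⟩ := LinearMap.funLeft_surjective_of_injective ℝ ℝ _ Subtype.val_injective g
    exact Submodule.mem_comap.1 (htop ▸ Submodule.mem_top : b ∈ q E)
  have hne := Subspace.biUnion_ne_univ_of_top_notMem (s := 𝓔.image q) fun h => by
    obtain ⟨E, hE, h⟩ := Finset.mem_image.1 h
    exact hq E hE h
  obtain ⟨b, hb⟩ := (Set.ne_univ_iff_exists_notMem _).1 hne
  exact ⟨b, fun E hE hmem => hb (Set.mem_biUnion (Finset.mem_image_of_mem q hE) hmem)⟩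

theorem eventually_forall_mem_exists_le_abs_sub {ε : Type*} [Finite ε]
    {L : Submodule ℝ (ε → ℝ)} {b : ε → ℝ} (hb : b ∉ L) :
    ∀ᶠ δ in 𝓝[>] (0 : ℝ), ∀ p ∈ L, ∃ e, δ ≤ |b e - p e| := by
  have := Fintype.ofFinite ε
  obtain ⟨δ₀, hδ₀, hball⟩ :=
    Metric.isOpen_iff.1 (Submodule.closed_of_finiteDimensional L).isOpen_compl b hb
  filter_upwards [Ioo_mem_nhdsGT hδ₀] with δ hδ p hp
  by_contra! hclose
  refine hball (Metric.mem_ball.2 ?_) hp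
  rw [dist_comm]
  exact (dist_pi_lt_iff hδ.1).2 hclose |>.trans hδ.2

theorem exists_generic_weights {α β : Type*} (N : Finset α) (W : Finset β) :
    ∃ (b : α × β → ℝ) (δ : ℝ), 0 < δ ∧ ∀ S ⊆ W, S.Nonempty → ∀ E ⊆ N ×ˢ S,
      #N + #S ≤ #E → ∀ (z : α → ℝ) (y : β → ℝ), ∃ e ∈ E, δ ≤ |b e - (z e.1 - y e.2)| := by
  classical
  set L : ∀ E : Finset (α × β), Submodule ℝ (E → ℝ) := fun E =>
    LinearMap.range (potentialDiff (fun e : E => e.1.1) fun e : E => e.1.2)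
  set 𝓔 := {E ∈ (N ×ˢ W).powerset | L E ≠ ⊤}
  obtain ⟨b, hb⟩ := exists_forall_restrict_notMem 𝓔 fun E hE => (Finset.mem_filter.1 hE).2
  obtain ⟨δ, hδb, hδ⟩ := (((Finset.eventually_all 𝓔).2 fun E hE =>
    eventually_forall_mem_exists_le_abs_sub (hb E hE)).and self_mem_nhdsWithin).exists
  refine ⟨b, δ, hδ, fun S hS hSne E hE hcard z y => ?_⟩
  have hmem : E ∈ 𝓔 := Finset.mem_filter.2
    ⟨Finset.mem_powerset.2 (hE.trans (Finset.product_subset_product_right hS)),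
      range_potentialDiff_ne_top hE hSne hcard⟩
  obtain ⟨e, he⟩ := hδb E hmem _ ⟨(z, y), rfl⟩
  exact ⟨e, e.2, by simpa only [potentialDiff_apply] using he⟩

end GenericWeights

section Split

variable {X β : Type*} {ρ : β → X → ℝ≥0} {c : β → ℝ} {δ : ℝ} {W : Finset β} {w : β} {x : X}

/-- The points of the support of `ρ w` at which `exp (c w) * ρ w` is, up to a factor less than
`exp δ`, maximal among the functions `exp (c w') * ρ w'`, `w' ∈ W`. -/
def nearMaxSet (ρ : β → X → ℝ≥0) (c : β → ℝ) (δ : ℝ) (W : Finset β) (w : β) : Set X :=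
  {x | ρ w x ≠ 0 ∧ ∀ w' ∈ W, Real.exp (c w') * ρ w' x < Real.exp δ * (Real.exp (c w) * ρ w x)}

theorem isOpen_nearMaxSet [TopologicalSpace X] (hρ : ∀ w, Continuous (ρ w)) :
    IsOpen (nearMaxSet ρ c δ W w) := by
  simp only [nearMaxSet, Set.ofPred_and, Set.ofPred_forall]
  have hρ' : ∀ w, Continuous fun x => (ρ w x : ℝ) := fun w => NNReal.continuous_coe.comp (hρ w)
  exact (isOpen_ne_fun (hρ w) continuous_const).inter <| isOpen_biInter_finset fun w' _ =>
    isOpen_lt ((hρ' w').const_mul _) (((hρ' w).const_mul _).const_mul _)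

theorem exists_isMax_exp_mul (c : β → ℝ) (hcov : ∃ w ∈ W, ρ w x ≠ 0) :
    ∃ w ∈ W, ρ w x ≠ 0 ∧ ∀ w' ∈ W, Real.exp (c w') * ρ w' x ≤ Real.exp (c w) * ρ w x := by
  obtain ⟨w₀, hw₀, hne⟩ := hcov
  obtain ⟨w, hw, hmax⟩ := W.exists_max_image (fun w => Real.exp (c w) * (ρ w x : ℝ)) ⟨w₀, hw₀⟩
  refine ⟨w, hw, fun hzero => ?_, hmax⟩
  have hpos : 0 < Real.exp (c w₀) * (ρ w₀ x : ℝ) :=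
    mul_pos (Real.exp_pos _) (NNReal.coe_pos.2 (pos_iff_ne_zero.2 hne))
  simpa [hzero] using hpos.trans_le (hmax w₀ hw₀)

theorem exists_mem_nearMaxSet (hδ : 0 < δ) (hcov : ∃ w ∈ W, ρ w x ≠ 0) :
    ∃ w ∈ W, x ∈ nearMaxSet ρ c δ W w := by
  obtain ⟨w, hw, hne, hmax⟩ := exists_isMax_exp_mul c hcov
  refine ⟨w, hw, hne, fun w' hw' => (hmax w' hw').trans_lt ?_⟩
  exact lt_mul_of_one_lt_left
    (mul_pos (Real.exp_pos _) (NNReal.coe_pos.2 (pos_iff_ne_zero.2 hne))) (Real.one_lt_exp_iff.2 hδ)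

theorem exists_forall_mem_nearMaxSet_abs_sub_lt (c : β → ℝ) (hcov : ∃ w ∈ W, ρ w x ≠ 0) :
    ∃ z : ℝ, ∀ w ∈ W, x ∈ nearMaxSet ρ c δ W w → |c w - (z - Real.log (ρ w x))| < δ := by
  obtain ⟨m, hm, hmne, hmax⟩ := exists_isMax_exp_mul c hcov
  have hlog : ∀ (t : ℝ) {p : ℝ}, 0 < p → Real.log (Real.exp t * p) = t + Real.log p :=
    fun t p hp => by rw [Real.log_mul (Real.exp_pos _).ne' hp.ne', Real.log_exp]
  refine ⟨c m + Real.log (ρ m x), fun w hw hx => ?_⟩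
  have hpos : 0 < (ρ w x : ℝ) := NNReal.coe_pos.2 (pos_iff_ne_zero.2 hx.1)
  have hmpos : 0 < (ρ m x : ℝ) := NNReal.coe_pos.2 (pos_iff_ne_zero.2 hmne)
  have hle := Real.log_le_log (mul_pos (Real.exp_pos _) hpos) (hmax w hw)
  have hlt := Real.log_lt_log (mul_pos (Real.exp_pos _) hmpos) (hx.2 m hm)
  rw [hlog _ hpos, hlog _ hmpos] at hle
  rw [hlog _ (mul_pos (Real.exp_pos _) hpos), hlog _ hpos, hlog _ hmpos] at hlt
  rw [abs_lt]
  constructor <;> linarith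

theorem IsOpenCover.exists_split [TopologicalSpace X] [NormalSpace X] {𝒲 : Finset (Set X)}
    (h : IsOpenCover 𝒲) {ι : Type*} (N : Finset ι) :
    ∃ V : ι → Set X → Set X, (∀ n, ∀ w ∈ 𝒲, IsOpen (V n w) ∧ V n w ⊆ w) ∧
      (∀ n x, ∃ w ∈ 𝒲, x ∈ V n w) ∧
      ∀ x, ∑ n ∈ N, ((multiplicityAt 𝒲 (V n) x : ℝ) - 1) ≤ ordAt 𝒲 x := by
  classical
  obtain ⟨ρ, hρc, hρs, hρp⟩ := h.exists_subordinate
  obtain ⟨b, δ, hδ, hb⟩ := exists_generic_weights N 𝒲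
  have hsub : ∀ w ∈ 𝒲, (ρ w).support ⊆ w := fun w hw => (subset_tsupport _).trans (hρs w hw)
  refine ⟨fun n => nearMaxSet ρ (fun w => b (n, w)) δ 𝒲,
    fun n w hw => ⟨isOpen_nearMaxSet hρc, fun x hx => hsub w hw hx.1⟩,
    fun n x => exists_mem_nearMaxSet hδ (hρp x), fun x => ?_⟩
  set V : ι → Set X → Set X := fun n => nearMaxSet ρ (fun w => b (n, w)) δ 𝒲
  -- On the bipartite graph of the pairs `(n, w)` with `x ∈ V n w`, the weights are within `δ` of a
  -- difference of potentials, so by genericity it has fewer edges than vertices.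
  set S := {w ∈ 𝒲 | ρ w x ≠ 0}
  set E := {e ∈ N ×ˢ 𝒲 | x ∈ V e.1 e.2}
  have hES : E ⊆ N ×ˢ S := fun e he => by
    obtain ⟨hNW, hx⟩ := Finset.mem_filter.1 he
    obtain ⟨hN, hW⟩ := Finset.mem_product.1 hNW
    exact Finset.mem_product.2 ⟨hN, Finset.mem_filter.2 ⟨hW, hx.1⟩⟩
  have hlt : #E < #N + #S := by
    by_contra! hcard
    choose z hz using fun n => exists_forall_mem_nearMaxSet_abs_sub_lt (δ := δ)
      (fun w => b (n, w)) (hρp x)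
    obtain ⟨e, he, hfar⟩ := hb S (Finset.filter_subset _ _)
      (Finset.filter_nonempty_iff.2 (hρp x)) E hES hcard z fun w => Real.log (ρ w x)
    obtain ⟨hNW, hx⟩ := Finset.mem_filter.1 he
    exact hfar.not_gt (hz e.1 e.2 (Finset.mem_product.1 hNW).2 hx)
  have hS : #S ≤ multiplicityAt 𝒲 id x :=
    Finset.card_le_card (Finset.monotone_filter_right _ fun w hw hx => hsub w hw hx)
  have hE : #E = ∑ n ∈ N, multiplicityAt 𝒲 (V n) x := by
    rw [← multiplicityAt_product]
    exact congrArg Finset.card (Finset.filter_congr_decidable _ _ _)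
  have hbound : ∑ n ∈ N, multiplicityAt 𝒲 (V n) x + 1 ≤ multiplicityAt 𝒲 id x + #N := by lia
  rw [ordAt_eq_multiplicityAt_sub_one, Finset.sum_sub_distrib, Finset.sum_const, nsmul_one,
    sub_le_sub_iff]
  exact_mod_cast hbound

end Split

/-! ### Invariant measures as limits of empirical measures -/

section InvariantMeasures

open scoped BoundedContinuousFunction

section Semicontinuity

variable {X : Type*} [TopologicalSpace X] [HasOuterApproxClosed X] [MeasurableSpace X]
  [OpensMeasurableSpace X]

theorem upperSemicontinuous_measureReal_of_isClosed {C : Set X} (hC : IsClosed C) :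
    UpperSemicontinuous fun μ : ProbabilityMeasure X => (μ : Measure X).real C := by
  intro μ c hμc
  have hlt : (μ : Measure X) C < ENNReal.ofReal c := by
    rw [← ofReal_measureReal (measure_ne_top _ _)]
    exact (ENNReal.ofReal_lt_ofReal_iff (measureReal_nonneg.trans_lt hμc)).2 hμc
  have hlimsup := ProbabilityMeasure.limsup_measure_closed_le_of_tendsto
    (tendsto_id (x := 𝓝 μ)) hC
  filter_upwards [eventually_lt_of_limsup_lt (hlimsup.trans_lt hlt)] with ν hν
  exact (ENNReal.lt_ofReal_iff_toReal_lt (measure_ne_top _ _)).1 hν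

end Semicontinuity

variable {Γ : Type*} [Group Γ] {X : Type*} [MulAction Γ X] [MeasurableSpace X]

theorem mem_invariantProb_iff_forall_integral_eq [TopologicalSpace X] [BorelSpace X]
    [HasOuterApproxClosed X] [ContinuousConstSMul Γ X] {μ : ProbabilityMeasure X} :
    (μ : Measure X) ∈ invariantProb Γ X ↔
      ∀ (γ : Γ) (f : X →ᵇ ℝ), ∫ y, f (γ • y) ∂(μ : Measure X) = ∫ y, f y ∂(μ : Measure X) := by
  have hcont (γ : Γ) := continuous_const_smul (T := X) γ
  refine ⟨fun hμ γ f => ?_, fun h => ⟨inferInstance, ⟨fun γ s hs => ?_⟩⟩⟩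
  · have := hμ.2
    exact integral_smul_eq_self (μ := (μ : Measure X)) f
  · have : IsProbabilityMeasure ((μ : Measure X).map (γ • ·)) :=
      Measure.isProbabilityMeasure_map (hcont γ).aemeasurable
    have heq : (μ : Measure X).map (γ • ·) = μ := by
      refine ext_of_forall_integral_eq_of_IsFiniteMeasure fun f => ?_
      rw [integral_map (hcont γ).aemeasurable f.continuous.aestronglyMeasurable]
      exact h γ f
    rw [← Measure.map_apply (hcont γ).measurable hs, heq]

theorem continuous_integral_smul [TopologicalSpace X] [OpensMeasurableSpace X]
    [ContinuousConstSMul Γ X] (γ : Γ) (f : X →ᵇ ℝ) :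
    Continuous fun μ : ProbabilityMeasure X => ∫ y, f (γ • y) ∂(μ : Measure X) :=
  ProbabilityMeasure.continuous_integral_boundedContinuousFunction
    (f.compContinuous ⟨(γ • ·), continuous_const_smul γ⟩)

section Compact

variable [TopologicalSpace X] [T2Space X] [CompactSpace X] [BorelSpace X]
  [HasOuterApproxClosed X] [ContinuousConstSMul Γ X]

variable (Γ X) in
theorem isCompact_setOf_mem_invariantProb :
    IsCompact {μ : ProbabilityMeasure X | (μ : Measure X) ∈ invariantProb Γ X} := by
  simp only [mem_invariantProb_iff_forall_integral_eq, Set.ofPred_forall]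
  exact (isClosed_iInter fun γ => isClosed_iInter fun f => isClosed_eq
    (continuous_integral_smul γ f)
    (ProbabilityMeasure.continuous_integral_boundedContinuousFunction f)).isCompact

theorem eventually_mem_of_invariantProb_subset {ι : Type*} {l : Filter ι}
    {ν : ι → ProbabilityMeasure X}
    (hν : ∀ (γ : Γ) (f : X →ᵇ ℝ), Tendsto
      (fun i => ∫ y, f (γ • y) ∂(ν i : Measure X) - ∫ y, f y ∂(ν i : Measure X)) l (𝓝 0))
    {𝒪 : Set (ProbabilityMeasure X)} (h𝒪 : IsOpen 𝒪)
    (hinv : {μ : ProbabilityMeasure X | (μ : Measure X) ∈ invariantProb Γ X} ⊆ 𝒪) :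
    ∀ᶠ i in l, ν i ∈ 𝒪 := by
  refine mem_iff_ultrafilter.2 fun U hU => ?_
  obtain ⟨μ, -, hμ⟩ := isCompact_univ.ultrafilter_le_nhds (U.map ν) (by simp)
  have hlim : Tendsto ν U (𝓝 μ) := hμ
  have hμinv : (μ : Measure X) ∈ invariantProb Γ X := by
    refine mem_invariantProb_iff_forall_integral_eq.2 fun γ f => sub_eq_zero.1 ?_
    refine tendsto_nhds_unique ?_ ((hν γ f).mono_left hU)
    exact (((continuous_integral_smul γ f).tendsto μ).comp hlim).sub
      (((ProbabilityMeasure.continuous_integral_boundedContinuousFunction f).tendsto μ).comp hlim)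
  exact hlim (h𝒪.mem_nhds (hinv hμinv))

end Compact

theorem abs_sum_sub_sum_le {α : Type*} [DecidableEq α] (A B : Finset α) {f : α → ℝ} {M : ℝ}
    (hf : ∀ a, |f a| ≤ M) : |∑ a ∈ A, f a - ∑ a ∈ B, f a| ≤ M * #(A ∆ B) := by
  have hsum (C : Finset α) : |∑ a ∈ C, f a| ≤ M * #C := by
    rw [mul_comm, ← nsmul_eq_mul]
    exact (Finset.abs_sum_le_sum_abs _ _).trans (Finset.sum_le_card_nsmul _ _ _ fun a _ => hf a)
  calc |∑ a ∈ A, f a - ∑ a ∈ B, f a|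
      = |∑ a ∈ A \ B, f a - ∑ a ∈ B \ A, f a| := by rw [← Finset.sum_sdiff_sub_sum_sdiff]
    _ ≤ |∑ a ∈ A \ B, f a| + |∑ a ∈ B \ A, f a| := abs_sub _ _
    _ ≤ M * #(A \ B) + M * #(B \ A) := add_le_add (hsum _) (hsum _)
    _ = M * #(A ∆ B) := by
      rw [symmDiff_def, Finset.sup_eq_union, Finset.card_union_of_disjoint disjoint_sdiff_sdiff]
      push_cast
      ring

theorem tendsto_escape_div_card [DecidableEq Γ] (g : Γ) :
    Tendsto (fun D => (escape g D : ℝ) / #D) (folnerFilter Γ) (𝓝 0) := by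
  refine tendsto_order.2 ⟨fun a ha => .of_forall fun D => ha.trans_le (by positivity),
    fun a ha => ?_⟩
  filter_upwards [eventually_isRightInvariantSet {g} (half_pos ha)] with D hD
  have hcard : (0 : ℝ) < #D := by exact_mod_cast hD.1.card_pos
  exact (div_le_of_le_mul₀ hcard.le (half_pos ha).le
    (hD.2 g (Finset.mem_singleton_self g))).trans_lt (half_lt_self ha)

/-- The uniform distribution on the points `γ⁻¹ • x` with `γ ∈ D`. The inverses make left Følner
averages invariant when `D` is almost invariant under right multiplications. -/
noncomputable def empirical (D : Finset Γ) (x : X) : Measure X :=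
  (#D : ℝ≥0∞)⁻¹ • ∑ γ ∈ D, Measure.dirac (γ⁻¹ • x)

theorem isProbabilityMeasure_empirical {D : Finset Γ} (hD : D.Nonempty) (x : X) :
    IsProbabilityMeasure (empirical D x) := by
  constructor
  simp only [empirical, Measure.smul_apply, Measure.finsetSum_apply, measure_univ,
    Finset.sum_const, nsmul_eq_mul, mul_one, smul_eq_mul]
  exact ENNReal.inv_mul_cancel (by exact_mod_cast hD.card_pos.ne') (ENNReal.natCast_ne_top _)

theorem integral_empirical [MeasurableSingletonClass X] (D : Finset Γ) (x : X) (f : X → ℝ) :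
    ∫ y, f y ∂(empirical D x) = (#D : ℝ)⁻¹ * ∑ γ ∈ D, f (γ⁻¹ • x) := by
  rw [empirical, integral_smul_measure,
    integral_finsetSum_measure fun γ _ => integrable_dirac enorm_lt_top]
  simp

theorem abs_integral_smul_empirical_sub_le [MeasurableSingletonClass X] [DecidableEq Γ]
    (D : Finset Γ) (x : X) (γ : Γ) {f : X → ℝ} {M : ℝ} (hf : ∀ y, |f y| ≤ M) :
    |∫ y, f (γ • y) ∂(empirical D x) - ∫ y, f y ∂(empirical D x)| ≤
      2 * M * (escape γ⁻¹ D / #D) := by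
  have hshift : ∑ g ∈ D, f (γ • g⁻¹ • x) = ∑ g ∈ D.image (· * γ⁻¹), f (g⁻¹ • x) := by
    rw [Finset.sum_image fun a _ b _ => mul_right_cancel]
    simp only [mul_inv_rev, inv_inv, mul_smul]
  rw [integral_empirical, integral_empirical, hshift, ← mul_sub, abs_mul,
    abs_of_nonneg (by positivity)]
  calc (#D : ℝ)⁻¹ * |∑ g ∈ D.image (· * γ⁻¹), f (g⁻¹ • x) - ∑ g ∈ D, f (g⁻¹ • x)|
      ≤ (#D : ℝ)⁻¹ * (M * #(D.image (· * γ⁻¹) ∆ D)) := by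
        gcongr
        exact abs_sum_sub_sum_le _ _ fun g => hf _
    _ = 2 * M * (escape γ⁻¹ D / #D) := by
        rw [card_image_symmDiff_eq_two_mul (mul_left_injective γ⁻¹), escape]
        push_cast
        ring

variable [MetricSpace X] [CompactSpace X] [BorelSpace X] [ContinuousConstSMul Γ X]

theorem eventually_sum_multiplicityAt_le [DecidableEq Γ] {ι : Type*} (J : Finset ι)
    {C : ι → Set X} (hC : ∀ j ∈ J, IsClosed (C j)) {c : ℝ}
    (hc : ∀ μ ∈ invariantProb Γ X, ∑ j ∈ J, μ.real (C j) < c) :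
    ∀ᶠ D in folnerFilter Γ, ∀ x : X, ∑ γ ∈ D, (multiplicityAt J C (γ⁻¹ • x) : ℝ) ≤ c * #D := by
  let ν (p : {D : Finset Γ // D.Nonempty} × X) : ProbabilityMeasure X :=
    ⟨empirical p.1.1 p.2, isProbabilityMeasure_empirical p.1.2 p.2⟩
  have hν (γ : Γ) (f : X →ᵇ ℝ) : Tendsto
      (fun p => ∫ y, f (γ • y) ∂(ν p : Measure X) - ∫ y, f y ∂(ν p : Measure X))
      (comap (fun p => p.1.1) (folnerFilter Γ)) (𝓝 0) := by
    refine squeeze_zero_norm (fun p =>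
      abs_integral_smul_empirical_sub_le p.1.1 p.2 γ f.norm_coe_le_norm) ?_
    simpa using ((tendsto_escape_div_card γ⁻¹).comp tendsto_comap).const_mul (2 * ‖f‖)
  have hopen : IsOpen {μ : ProbabilityMeasure X | ∑ j ∈ J, (μ : Measure X).real (C j) < c} :=
    (upperSemicontinuous_sum fun j hj =>
      upperSemicontinuous_measureReal_of_isClosed (hC j hj)).isOpen_preimage c
  have hev := eventually_mem_of_invariantProb_subset hν hopen fun μ hμ => hc μ hμ
  filter_upwards [eventually_comap.1 hev, eventually_nonempty_folnerFilter] with D hD hne x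
  have := isProbabilityMeasure_empirical hne x
  have hlt : ∑ j ∈ J, (empirical D x).real (C j) < c := hD (⟨D, hne⟩, x) rfl
  rw [← integral_multiplicityAt fun j hj => (hC j hj).measurableSet, integral_empirical,
    inv_mul_lt_iff₀ (by exact_mod_cast hne.card_pos), mul_comm] at hlt
  exact hlt.le

theorem exists_isOpen_superset_measureReal_lt {C : Set X} (hC : IsClosed C) {c : ℝ}
    (hc : ∀ μ ∈ invariantProb Γ X, μ.real C < c) :
    ∃ O : Set X, IsOpen O ∧ C ⊆ O ∧ ∀ μ ∈ invariantProb Γ X, μ.real O < c := by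
  have hthick (μ : ProbabilityMeasure X) (hμ : (μ : Measure X) ∈ invariantProb Γ X) :
      ∃ r : Set.Ioi (0 : ℝ), (μ : Measure X).real (Metric.cthickening r C) < c := by
    have hlim := (ENNReal.continuousAt_toReal (measure_ne_top (μ : Measure X) C)).tendsto.comp
      (tendsto_measure_cthickening_of_isClosed ⟨1, one_pos, measure_ne_top _ _⟩ hC)
    obtain ⟨r, hr, hr0⟩ := (((hlim.mono_left nhdsWithin_le_nhds).eventually_lt_const
      (hc μ hμ)).and (self_mem_nhdsWithin (s := Set.Ioi (0 : ℝ)))).exists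
    exact ⟨⟨r, hr0⟩, hr⟩
  obtain ⟨r, hr⟩ := (isCompact_setOf_mem_invariantProb Γ X).elim_directed_cover
    (fun r : Set.Ioi (0 : ℝ) =>
      {μ : ProbabilityMeasure X | (μ : Measure X).real (Metric.cthickening r C) < c})
    (fun r => (upperSemicontinuous_measureReal_of_isClosed
      Metric.isClosed_cthickening).isOpen_preimage c)
    (fun μ hμ => Set.mem_iUnion.2 (hthick μ hμ))
    (directed_of_isDirected_ge fun r s hrs μ hμ =>
      (measureReal_mono (Metric.cthickening_mono hrs C)).trans_lt hμ)
  exact ⟨_, Metric.isOpen_thickening, Metric.self_subset_thickening r.2 C, fun μ hμ =>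
    have := hμ.1
    (measureReal_mono (Metric.thickening_subset_cthickening _ C)).trans_lt
      (hr (show ((⟨μ, this⟩ : ProbabilityMeasure X) : Measure X) ∈ invariantProb Γ X from hμ))⟩

end InvariantMeasures

/-! ### The order of a cover as a subadditive function -/

section CoverOrder

variable {X : Type*} [TopologicalSpace X]

/-- `𝒰` has a finite open refinement of order at most `d`. -/
def HasOrderLE (𝒰 : Set (Set X)) (d : ℝ) : Prop :=
  ∃ 𝒱 : Finset (Set X), IsOpenCover 𝒱 ∧ Refines (𝒱 : Set (Set X)) 𝒰 ∧ ∀ x, ordAt 𝒱 x ≤ d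

/-- The dimension of a cover as a natural number; it agrees with `coverDim` if `X` is nonempty and
the cover has a finite open refinement. -/
noncomputable def coverOrder (𝒰 : Set (Set X)) : ℕ := sInf {n : ℕ | HasOrderLE 𝒰 n}

theorem HasOrderLE.mono {𝒰 : Set (Set X)} {d e : ℝ} (h : HasOrderLE 𝒰 d) (hde : d ≤ e) :
    HasOrderLE 𝒰 e := by
  obtain ⟨𝒱, h𝒱, href, hord⟩ := h
  exact ⟨𝒱, h𝒱, href, fun x => (hord x).trans hde⟩

theorem HasOrderLE.hasOrderLE_coverOrder {𝒰 : Set (Set X)} {d : ℝ} (h : HasOrderLE 𝒰 d) :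
    HasOrderLE 𝒰 (coverOrder 𝒰) :=
  Nat.sInf_mem (s := {n : ℕ | HasOrderLE 𝒰 n}) ⟨⌈d⌉₊, h.mono (Nat.le_ceil d)⟩

theorem IsOpenCover.exists_ordAt_eq_natCast {𝒱 : Finset (Set X)} (h : IsOpenCover 𝒱) (x : X) :
    ∃ n : ℕ, ordAt 𝒱 x = n := by
  obtain ⟨n, hn⟩ := Nat.exists_eq_succ_of_ne_zero
    (multiplicityAt_pos (A := id).2 (h.exists_mem x)).ne'
  exact ⟨n, by rw [ordAt_eq_multiplicityAt_sub_one, hn, Nat.cast_succ, add_sub_cancel_right]⟩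

variable [Nonempty X]

theorem HasOrderLE.nonneg {𝒰 : Set (Set X)} {d : ℝ} (h : HasOrderLE 𝒰 d) : 0 ≤ d := by
  obtain ⟨𝒱, h𝒱, -, hord⟩ := h
  obtain ⟨x⟩ := ‹Nonempty X›
  obtain ⟨n, hn⟩ := h𝒱.exists_ordAt_eq_natCast x
  exact n.cast_nonneg.trans (hn ▸ hord x)

theorem HasOrderLE.coverOrder_le {𝒰 : Set (Set X)} {d : ℝ} (h : HasOrderLE 𝒰 d) :
    coverOrder 𝒰 ≤ d := by
  refine le_trans (Nat.cast_le.2 (Nat.sInf_le ?_)) (Nat.floor_le h.nonneg)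
  obtain ⟨𝒱, h𝒱, href, hord⟩ := h
  refine ⟨𝒱, h𝒱, href, fun x => ?_⟩
  obtain ⟨n, hn⟩ := h𝒱.exists_ordAt_eq_natCast x
  rw [hn]
  exact Nat.cast_le.2 (Nat.le_floor (hn ▸ hord x))

theorem HasOrderLE.coverDim_eq {𝒰 : Set (Set X)} {d : ℝ} (h : HasOrderLE 𝒰 d) :
    coverDim 𝒰 = ((coverOrder 𝒰 : ℝ) : EReal) := by
  refine le_antisymm ?_ (le_iInf₂ fun 𝒱 h𝒱 => ?_)
  · obtain ⟨𝒱, h𝒱, href, hord⟩ := h.hasOrderLE_coverOrder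
    exact iInf₂_le_of_le 𝒱 ⟨h𝒱, href⟩ (iSup_le fun x => EReal.coe_le_coe_iff.2 (hord x))
  · by_contra! hlt
    have hord : HasOrderLE 𝒰 ((coverOrder 𝒰 : ℝ) - 1) := by
      refine ⟨𝒱, h𝒱.1, h𝒱.2, fun x => ?_⟩
      have hx : ordAt 𝒱 x < coverOrder 𝒰 := EReal.coe_lt_coe_iff.1 <|
        (le_iSup (fun x => (ordAt 𝒱 x : EReal)) x).trans_lt hlt
      obtain ⟨n, hn⟩ := h𝒱.1.exists_ordAt_eq_natCast x
      rw [hn, Nat.cast_lt] at hx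
      rw [hn, le_sub_iff_add_le]
      exact_mod_cast hx
    linarith [hord.coverOrder_le]

end CoverOrder

section IteratedJoin

variable {Γ : Type*} [Group Γ] {X : Type*} [MulAction Γ X]

theorem refines_iteratedJoin_iff {𝒲 : Set (Set X)} {F : Finset Γ} {𝒰 : Finset (Set X)} :
    Refines 𝒲 (iteratedJoin F 𝒰) ↔ ∀ W ∈ 𝒲, ∀ γ ∈ F, ∃ U ∈ 𝒰, W ⊆ γ • U := by
  refine ⟨fun h W hW γ hγ => ?_, fun h W hW => ?_⟩
  · obtain ⟨_, ⟨u, hu, rfl⟩, hWu⟩ := h W hW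
    exact ⟨u γ, hu γ hγ, hWu.trans (Set.biInter_subset_of_mem hγ)⟩
  · choose! u hu hWu using h W hW
    exact ⟨_, ⟨u, hu, rfl⟩, Set.subset_iInter₂ hWu⟩

variable [TopologicalSpace X] [ContinuousConstSMul Γ X] {𝒰 : Finset (Set X)}

theorem IsOpenCover.smul [DecidableEq (Set X)] {𝒱 : Finset (Set X)} (h : IsOpenCover 𝒱) (c : Γ) :
    IsOpenCover (c • 𝒱) := by
  refine isOpenCover_of_forall_exists_mem (fun V hV => ?_) fun x => ?_
  · obtain ⟨W, hW, rfl⟩ := Finset.mem_smul_finset.1 hV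
    exact (h.1 W hW).smul c
  · obtain ⟨V, hV, hx⟩ := h.exists_mem (c⁻¹ • x)
    exact ⟨c • V, Finset.smul_mem_smul_finset hV, Set.mem_smul_set_iff_inv_smul_mem.2 hx⟩

omit [TopologicalSpace X] [ContinuousConstSMul Γ X] in
theorem ordAt_smul_le [DecidableEq (Set X)] (c : Γ) (𝒱 : Finset (Set X)) (x : X) :
    ordAt (c • 𝒱) x ≤ ordAt 𝒱 (c⁻¹ • x) := by
  refine (ordAt_image_le 𝒱 (fun V => c • V) x).trans ?_
  rw [ordAt_eq_multiplicityAt_sub_one]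
  gcongr
  exact multiplicityAt_mono fun _ _ => Set.mem_smul_set_iff_inv_smul_mem.1

theorem HasOrderLE.smul [DecidableEq Γ] {F : Finset Γ} {d : ℝ}
    (h : HasOrderLE (iteratedJoin F 𝒰) d) (c : Γ) : HasOrderLE (iteratedJoin (c • F) 𝒰) d := by
  classical
  obtain ⟨𝒱, h𝒱, href, hord⟩ := h
  rw [refines_iteratedJoin_iff] at href
  refine ⟨c • 𝒱, h𝒱.smul c, refines_iteratedJoin_iff.2 ?_, fun x =>
    (ordAt_smul_le c 𝒱 x).trans (hord _)⟩
  intro _ hcV _ hcγ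
  obtain ⟨V, hV, rfl⟩ := Finset.mem_smul_finset.1 (Finset.mem_coe.1 hcV)
  obtain ⟨γ, hγ, rfl⟩ := Finset.mem_smul_finset.1 hcγ
  obtain ⟨U, hU, hVU⟩ := href V hV γ hγ
  exact ⟨U, hU, (Set.smul_set_mono hVU).trans_eq (smul_assoc c γ U).symm⟩

theorem coverOrder_iteratedJoin_smul [DecidableEq Γ] (𝒰 : Finset (Set X)) (c : Γ)
    (F : Finset Γ) : coverOrder (iteratedJoin (c • F) 𝒰) = coverOrder (iteratedJoin F 𝒰) := by
  have hiff : ∀ n : ℕ, HasOrderLE (iteratedJoin (c • F) 𝒰) n ↔ HasOrderLE (iteratedJoin F 𝒰) n :=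
    fun n => ⟨fun h => by simpa using h.smul c⁻¹, fun h => h.smul c⟩
  simp only [coverOrder, hiff]

end IteratedJoin

section Subadditivity

variable {X : Type*} [TopologicalSpace X] [NormalSpace X]

theorem exists_common_refinement {ι : Type*} (J : Finset ι) {𝒱 : ι → Finset (Set X)}
    (h𝒱 : ∀ j, IsOpenCover (𝒱 j)) :
    ∃ 𝒲 : Finset (Set X), IsOpenCover 𝒲 ∧
      (∀ j ∈ J, Refines (𝒲 : Set (Set X)) (𝒱 j : Set (Set X))) ∧
      ∀ x, ordAt 𝒲 x ≤ ∑ j ∈ J, ordAt (𝒱 j) x := by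
  choose ρ hcont hsupp hpos using fun j => (h𝒱 j).exists_subordinate
  have hsub : ∀ j, ∀ V ∈ 𝒱 j, (ρ j V).support ⊆ V := fun j V hV =>
    (subset_tsupport _).trans (hsupp j V hV)
  obtain ⟨𝒲, h𝒲, href, hord⟩ := exists_openCover_ordAt_le_sum hcont fun j (_ : j ∈ J) => hpos j
  refine ⟨𝒲, h𝒲, fun j hj W hW => ?_, fun x => (hord x).trans (Finset.sum_le_sum fun j _ => ?_)⟩
  · obtain ⟨V, hV, hWV⟩ := href W hW j hj
    exact ⟨V, hV, hWV.trans (hsub j V hV)⟩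
  · rw [ordAt_eq_multiplicityAt_sub_one]
    gcongr
    exact multiplicityAt_mono fun V hV hx => hsub j V hV hx

variable {Γ : Type*} [Group Γ] [MulAction Γ X] {𝒰 : Finset (Set X)}

theorem HasOrderLE.union [DecidableEq Γ] {A B : Finset Γ} {a b : ℝ}
    (hA : HasOrderLE (iteratedJoin A 𝒰) a) (hB : HasOrderLE (iteratedJoin B 𝒰) b) :
    HasOrderLE (iteratedJoin (A ∪ B) 𝒰) (a + b) := by
  obtain ⟨𝒱, h𝒱, href𝒱, hord𝒱⟩ := hA
  obtain ⟨𝒱', h𝒱', href𝒱', hord𝒱'⟩ := hB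
  obtain ⟨𝒲, h𝒲, href, hord⟩ := exists_common_refinement Finset.univ
    (𝒱 := fun i : Bool => cond i 𝒱 𝒱') (Bool.forall_bool.2 ⟨h𝒱', h𝒱⟩)
  refine ⟨𝒲, h𝒲, refines_iteratedJoin_iff.2 fun W hW γ hγ => ?_, fun x => (hord x).trans ?_⟩
  · rw [refines_iteratedJoin_iff] at href𝒱 href𝒱'
    rcases Finset.mem_union.1 hγ with hγ | hγ
    · obtain ⟨V, hV, hWV⟩ := href true (Finset.mem_univ _) W hW
      exact (href𝒱 V hV γ hγ).imp fun U hU => ⟨hU.1, hWV.trans hU.2⟩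
    · obtain ⟨V, hV, hWV⟩ := href false (Finset.mem_univ _) W hW
      exact (href𝒱' V hV γ hγ).imp fun U hU => ⟨hU.1, hWV.trans hU.2⟩
  · rw [Fintype.sum_bool]
    exact add_le_add (hord𝒱 x) (hord𝒱' x)

variable [ContinuousConstSMul Γ X]

theorem hasOrderLE_iteratedJoin (h𝒰 : IsOpenCover 𝒰) (F : Finset Γ) :
    HasOrderLE (iteratedJoin F 𝒰) (#𝒰 * #F) := by
  classical
  obtain ⟨𝒲, h𝒲, href, hord⟩ := exists_common_refinement F fun γ => h𝒰.smul γ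
  refine ⟨𝒲, h𝒲, refines_iteratedJoin_iff.2 fun W hW γ hγ => ?_, fun x => (hord x).trans ?_⟩
  · obtain ⟨_, hV, hWV⟩ := href γ hγ W hW
    obtain ⟨U, hU, rfl⟩ := Finset.mem_smul_finset.1 (Finset.mem_coe.1 hV)
    exact ⟨U, hU, hWV⟩
  · rw [mul_comm, ← nsmul_eq_mul]
    refine Finset.sum_le_card_nsmul _ _ _ fun γ _ => (ordAt_smul_le γ 𝒰 x).trans ?_
    rw [ordAt_eq_multiplicityAt_sub_one, sub_le_iff_le_add]
    exact_mod_cast (Finset.card_filter_le _ _).trans (Nat.le_succ _)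

theorem isInvariantSubadditive_coverOrder [DecidableEq Γ] [Nonempty X] (h𝒰 : IsOpenCover 𝒰) :
    IsInvariantSubadditive (fun F : Finset Γ => (coverOrder (iteratedJoin F 𝒰) : ℝ)) #𝒰 where
  rate_nonneg := Nat.cast_nonneg _
  le_mul_card F := (hasOrderLE_iteratedJoin h𝒰 F).coverOrder_le
  smul_eq c F := by rw [coverOrder_iteratedJoin_smul]
  union_le A B := ((hasOrderLE_iteratedJoin h𝒰 A).hasOrderLE_coverOrder.union
    (hasOrderLE_iteratedJoin h𝒰 B).hasOrderLE_coverOrder).coverOrder_le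

end Subadditivity

/-! ### Comparison of mean dimension and dimension -/

section IntegratedOrder

variable {X κ : Type*} [MeasurableSpace X] {μ : Measure X}

theorem integral_ordAt [IsProbabilityMeasure μ] {𝒱 : Finset (Set X)}
    (h𝒱 : ∀ V ∈ 𝒱, MeasurableSet V) : ∫ x, ordAt 𝒱 x ∂μ = ∑ V ∈ 𝒱, μ.real V - 1 := by
  simp only [ordAt_eq_multiplicityAt_sub_one]
  rw [integral_sub (integrable_multiplicityAt (A := id) h𝒱) (integrable_const 1),
    integral_multiplicityAt (A := id) h𝒱, integral_const, probReal_univ, one_smul]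
  rfl

theorem integral_ordAt_image_le [IsProbabilityMeasure μ] [DecidableEq (Set X)] {I : Finset κ}
    {A : κ → Set X} (hA : ∀ k ∈ I, MeasurableSet (A k)) :
    ∫ x, ordAt (I.image A) x ∂μ ≤ ∑ k ∈ I, μ.real (A k) - 1 := by
  rw [integral_ordAt (Finset.forall_mem_image.2 hA)]
  gcongr
  exact Finset.sum_image_le_of_nonneg fun _ _ => measureReal_nonneg

theorem sum_measureReal_inter_le [IsFiniteMeasure μ] {I : Finset κ} {A : κ → Set X}
    (hA : ∀ k ∈ I, MeasurableSet (A k)) {m : ℝ} (hm : ∀ x, multiplicityAt I A x ≤ m)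
    (B : Set X) : ∑ k ∈ I, μ.real (B ∩ A k) ≤ m * μ.real B := by
  calc ∑ k ∈ I, μ.real (B ∩ A k) = ∫ x in B, (multiplicityAt I A x : ℝ) ∂μ := by
        rw [integral_multiplicityAt hA]
        exact Finset.sum_congr rfl fun k hk => by
          rw [measureReal_restrict_apply (hA k hk), Set.inter_comm]
    _ ≤ ∫ _ in B, m ∂μ := integral_mono (integrable_multiplicityAt hA) (integrable_const m) hm
    _ = m * μ.real B := by rw [setIntegral_const, smul_eq_mul, mul_comm]

end IntegratedOrder

section Glue

variable {X ι : Type*} [TopologicalSpace X] [MeasurableSpace X] [OpensMeasurableSpace X]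

theorem IsOpenCover.exists_glue [Fintype ι] {𝒰 : Finset (Set X)} (h𝒰 : IsOpenCover 𝒰)
    {𝒯 : ι → Finset (Set X)} (hopen : ∀ i, ∀ T ∈ 𝒯 i, IsOpen T)
    (href : ∀ i, Refines (𝒯 i : Set (Set X)) (𝒰 : Set (Set X))) {O : Set X} (hO : IsOpen O)
    (hcov : ∀ x ∉ O, ∃ i, ∃ T ∈ 𝒯 i, x ∈ T) :
    ∃ 𝒱 : Finset (Set X), IsOpenCover 𝒱 ∧ Refines (𝒱 : Set (Set X)) (𝒰 : Set (Set X)) ∧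
      ∀ μ : Measure X, IsProbabilityMeasure μ →
        ∫ x, ordAt 𝒱 x ∂μ ≤ ∑ i, ∑ T ∈ 𝒯 i, μ.real T + #𝒰 * μ.real O - 1 := by
  classical
  let I : Finset ((Σ _ : ι, Set X) ⊕ Set X) := (Finset.univ.sigma 𝒯).disjSum 𝒰
  let A : (Σ _ : ι, Set X) ⊕ Set X → Set X := Sum.elim Sigma.snd (· ∩ O)
  have hI : ∀ k ∈ I, IsOpen (A k) ∧ ∃ U ∈ 𝒰, A k ⊆ U := by
    rintro (⟨i, T⟩ | U) hk
    · have hT : T ∈ 𝒯 i := (Finset.mem_sigma.1 (Finset.inl_mem_disjSum.1 hk)).2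
      exact ⟨hopen i T hT, href i T hT⟩
    · have hU : U ∈ 𝒰 := Finset.inr_mem_disjSum.1 hk
      exact ⟨(h𝒰.1 U hU).inter hO, U, hU, Set.inter_subset_left⟩
  refine ⟨I.image A, isOpenCover_of_forall_exists_mem
    (Finset.forall_mem_image.2 fun k hk => (hI k hk).1) fun x => ?_,
    Finset.forall_mem_image.2 fun k hk => (hI k hk).2, fun μ _ => ?_⟩
  · by_cases hx : x ∈ O
    · obtain ⟨U, hU, hxU⟩ := h𝒰.exists_mem x
      exact ⟨_, Finset.mem_image_of_mem A (Finset.inr_mem_disjSum.2 hU), hxU, hx⟩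
    · obtain ⟨i, T, hT, hxT⟩ := hcov x hx
      exact ⟨_, Finset.mem_image_of_mem A (a := Sum.inl ⟨i, T⟩) (Finset.inl_mem_disjSum.2
        (Finset.mem_sigma.2 ⟨Finset.mem_univ i, hT⟩)), hxT⟩
  · refine (integral_ordAt_image_le fun k hk => (hI k hk).1.measurableSet).trans ?_
    rw [Finset.sum_disjSum, Finset.sum_sigma]
    refine sub_le_sub_right (add_le_add le_rfl ?_) 1
    rw [← nsmul_eq_mul]
    exact Finset.sum_le_card_nsmul _ _ _ fun U _ => measureReal_mono Set.inter_subset_right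

end Glue

section Tower

variable {Γ : Type*} [Group Γ] {X : Type*} [MulAction Γ X] [MeasurableSpace X]

theorem measureReal_smul (μ : Measure X) [SMulInvariantMeasure Γ X μ] (γ : Γ) (A : Set X) :
    μ.real (γ • A) = μ.real A := by
  rw [measureReal_def, measure_smul, measureReal_def]

theorem sum_card_mul_measureReal_le_one [MeasurableConstSMul Γ X] {μ : Measure X}
    (hμ : μ ∈ invariantProb Γ X) {ι : Type*} [Fintype ι] {V : ι → Set X} {S : ι → Finset Γ}
    (hV : ∀ i, MeasurableSet (V i))
    (hdisj : ∀ i, ∀ γ ∈ S i, ∀ j, ∀ δ ∈ S j, (i, γ) ≠ (j, δ) → Disjoint (γ • V i) (δ • V j)) :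
    ∑ i, #(S i) * μ.real (V i) ≤ 1 := by
  have := hμ.1
  have := hμ.2
  have hpairwise : (Finset.univ.sigma S : Set (Σ _ : ι, Γ)).PairwiseDisjoint
      fun a => a.2 • V a.1 := fun a ha b hb hab => by
    refine hdisj _ _ (Finset.mem_sigma.1 ha).2 _ _ (Finset.mem_sigma.1 hb).2 fun h => hab ?_
    obtain ⟨hi, hγ⟩ := Prod.ext_iff.1 h
    exact Sigma.ext hi (heq_of_eq hγ)
  calc ∑ i, #(S i) * μ.real (V i) = ∑ i, ∑ γ ∈ S i, μ.real (γ • V i) := by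
        simp only [measureReal_smul, Finset.sum_const, nsmul_eq_mul]
    _ = μ.real (⋃ a ∈ Finset.univ.sigma S, a.2 • V a.1) := by
        rw [measureReal_biUnion_finset hpairwise fun a _ => (hV a.1).const_smul a.2,
          Finset.sum_sigma]
    _ ≤ 1 := measureReal_le_one

variable [TopologicalSpace X] [BorelSpace X] [NormalSpace X] [ContinuousConstSMul Γ X]
  {𝒰 : Finset (Set X)}

theorem HasOrderLE.exists_towerCover [DecidableEq Γ] {S : Finset Γ} {a : ℝ}
    (h : HasOrderLE (iteratedJoin S⁻¹ 𝒰) (a * #S)) {B : Set X} (hB : IsOpen B) :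
    ∃ 𝒯 : Finset (Set X), (∀ T ∈ 𝒯, IsOpen T) ∧ Refines (𝒯 : Set (Set X)) (𝒰 : Set (Set X)) ∧
      (∀ γ ∈ S, ∀ x ∈ γ • B, ∃ T ∈ 𝒯, x ∈ T) ∧
      ∀ μ ∈ invariantProb Γ X, ∑ T ∈ 𝒯, μ.real T ≤ (a + 1) * (#S * μ.real B) := by
  classical
  obtain ⟨𝒲, h𝒲, href, hord⟩ := h
  rw [refines_iteratedJoin_iff] at href
  obtain ⟨V, hV, hVcov, hVord⟩ := h𝒲.exists_split S
  let A : Γ × Set X → Set X := fun k => k.1 • (B ∩ V k.1 k.2)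
  refine ⟨(S ×ˢ 𝒲).image A, Finset.forall_mem_image.2 fun k hk => ?_,
    Finset.forall_mem_image.2 fun k hk => ?_, fun γ hγ x hx => ?_, fun μ hμ => ?_⟩
  · exact (hB.inter (hV k.1 k.2 (Finset.mem_product.1 hk).2).1).smul k.1
  · obtain ⟨hkS, hk𝒲⟩ := Finset.mem_product.1 hk
    obtain ⟨U, hU, hWU⟩ := href k.2 hk𝒲 k.1⁻¹ (Finset.inv_mem_inv hkS)
    exact ⟨U, hU, Set.smul_set_subset_iff_subset_inv_smul_set.2 <|
      Set.inter_subset_right.trans ((hV k.1 k.2 hk𝒲).2.trans hWU)⟩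
  · obtain ⟨W, hW, hxW⟩ := hVcov γ (γ⁻¹ • x)
    refine ⟨A (γ, W), Finset.mem_image_of_mem A (Finset.mk_mem_product hγ hW), ?_⟩
    exact Set.mem_smul_set_iff_inv_smul_mem.2 ⟨Set.mem_smul_set_iff_inv_smul_mem.1 hx, hxW⟩
  · have := hμ.1
    have := hμ.2
    have hmult : ∀ x, multiplicityAt (S ×ˢ 𝒲) (fun k => V k.1 k.2) x ≤ (a + 1) * #S := fun x => by
      have hx := (hVord x).trans (hord x)
      rw [Finset.sum_sub_distrib, Finset.sum_const, nsmul_one] at hx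
      rw [multiplicityAt_product, Nat.cast_sum]
      linarith
    calc ∑ T ∈ (S ×ˢ 𝒲).image A, μ.real T ≤ ∑ k ∈ S ×ˢ 𝒲, μ.real (A k) :=
          Finset.sum_image_le_of_nonneg fun _ _ => measureReal_nonneg
      _ = ∑ k ∈ S ×ˢ 𝒲, μ.real (B ∩ V k.1 k.2) := by simp only [A, measureReal_smul]
      _ ≤ (a + 1) * #S * μ.real B := sum_measureReal_inter_le
          (fun k hk => (hV k.1 k.2 (Finset.mem_product.1 hk).2).1.measurableSet) hmult B
      _ = (a + 1) * (#S * μ.real B) := mul_assoc _ _ _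

end Tower

section Comparison

variable {Γ : Type*} [Group Γ] {X : Type*} [MulAction Γ X] [MeasurableSpace X]

variable (Γ) in
/-- The contribution of the cover `𝒰` to `dynDim Γ X`, which is the counterpart of
`lim dim(⋁_{γ ∈ F} T_γ(𝒰)) / |F|`. -/
noncomputable def dynCoverDim [TopologicalSpace X] (𝒰 : Finset (Set X)) : EReal :=
  ⨅ (𝒱 : Finset (Set X)) (_ : IsOpenCover 𝒱 ∧ Refines (𝒱 : Set (Set X)) (𝒰 : Set (Set X))),
    ⨆ μ ∈ invariantProb Γ X, ((∫ x, ordAt 𝒱 x ∂μ : ℝ) : EReal)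

omit [MeasurableSpace X] in
theorem isOpenCover_empty [TopologicalSpace X] [IsEmpty X] : IsOpenCover (∅ : Finset (Set X)) :=
  isOpenCover_of_forall_exists_mem (by simp) isEmptyElim

omit [MeasurableSpace X] in
theorem coverDim_of_isEmpty [TopologicalSpace X] [IsEmpty X] (𝒰 : Set (Set X)) :
    coverDim 𝒰 = ⊥ :=
  le_bot_iff.1 (iInf₂_le_of_le ∅ ⟨isOpenCover_empty, by simp [Refines]⟩ (by simp [ord]))

theorem dynCoverDim_of_isEmpty [TopologicalSpace X] [IsEmpty X] (𝒰 : Finset (Set X)) :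
    dynCoverDim Γ 𝒰 = ⊥ := by
  refine le_bot_iff.1 (iInf₂_le_of_le ∅ ⟨isOpenCover_empty, by simp [Refines]⟩
    (iSup₂_le fun μ hμ => ?_))
  have := hμ.1
  exact isEmptyElim (nonempty_of_isProbabilityMeasure μ).some

variable [MetricSpace X] [CompactSpace X] [BorelSpace X] [ContinuousConstSMul Γ X]
  [DecidableEq Γ] {𝒰 : Finset (Set X)}

theorem eventually_hasOrderLE {𝒱 : Finset (Set X)} (h𝒱 : IsOpenCover 𝒱)
    (href : Refines (𝒱 : Set (Set X)) 𝒰) {c : ℝ}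
    (hc : ∀ μ ∈ invariantProb Γ X, ∫ x, ordAt 𝒱 x ∂μ < c) :
    ∀ᶠ D in folnerFilter Γ, HasOrderLE (iteratedJoin D 𝒰) (c * #D) := by
  obtain ⟨ρ, hcont, hsupp, hpos⟩ := h𝒱.exists_subordinate
  have hmass : ∀ μ ∈ invariantProb Γ X, ∑ V ∈ 𝒱, μ.real (tsupport (ρ V)) < c + 1 := fun μ hμ => by
    have := hμ.1
    have hμc := hc μ hμ
    rw [integral_ordAt fun V hV => (h𝒱.1 V hV).measurableSet, sub_lt_iff_lt_add] at hμc
    exact (Finset.sum_le_sum fun V hV => measureReal_mono (hsupp V hV)).trans_lt hμc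
  filter_upwards [eventually_sum_multiplicityAt_le 𝒱 (fun V _ => isClosed_tsupport (ρ V)) hmass]
    with D hD
  obtain ⟨𝒲, h𝒲, hsub, hord⟩ := exists_openCover_ordAt_le_sum (J := D) (K := fun _ => 𝒱)
    (f := fun γ V x => ρ V (γ⁻¹ • x)) (fun γ V => (hcont V).comp (continuous_const_smul γ⁻¹))
    (fun γ _ x => hpos (γ⁻¹ • x))
  refine ⟨𝒲, h𝒲, refines_iteratedJoin_iff.2 fun W hW γ hγ => ?_, fun x => (hord x).trans ?_⟩
  · obtain ⟨V, hV, hWV⟩ := hsub W hW γ hγ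
    obtain ⟨U, hU, hVU⟩ := href V hV
    exact ⟨U, hU, fun x hx => Set.mem_smul_set_iff_inv_smul_mem.2 <|
      hVU (hsupp V hV (subset_tsupport _ (hWV hx)))⟩
  · have hle : ∑ γ ∈ D, (multiplicityAt 𝒱 (fun V => (fun x => ρ V (γ⁻¹ • x)).support) x : ℝ) ≤
        ∑ γ ∈ D, (multiplicityAt 𝒱 (fun V => tsupport (ρ V)) (γ⁻¹ • x) : ℝ) := by
      gcongr with γ
      exact multiplicityAt_mono fun V _ hx => subset_tsupport (ρ V) hx
    rw [Finset.sum_sub_distrib, Finset.sum_const, nsmul_one]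
    linarith [hD x]

theorem HasURP.exists_refinement (hX : HasURP Γ X) (h𝒰 : IsOpenCover 𝒰) {a b : ℝ} (ha : 0 ≤ a)
    (hab : a < b) (h : ∀ᶠ D in folnerFilter Γ, HasOrderLE (iteratedJoin D 𝒰) (a * #D)) :
    ∃ 𝒱 : Finset (Set X), IsOpenCover 𝒱 ∧ Refines (𝒱 : Set (Set X)) (𝒰 : Set (Set X)) ∧
      ∀ μ ∈ invariantProb Γ X, ∫ x, ordAt 𝒱 x ∂μ ≤ b := by
  obtain ⟨K, δ, hδ, hK⟩ := eventually_folnerFilter.1 h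
  obtain ⟨ε, hε, hεδ, hεb⟩ : ∃ ε : ℝ, 0 < ε ∧ ε ≤ δ ∧ #𝒰 * ε ≤ b - a := by
    refine ⟨min δ ((b - a) / (#𝒰 + 1)), lt_min hδ (div_pos (sub_pos.2 hab) (by positivity)),
      min_le_left _ _, ?_⟩
    refine (mul_le_mul_of_nonneg_left (min_le_right _ _) (Nat.cast_nonneg _)).trans ?_
    rw [mul_div_assoc', div_le_iff₀ (by positivity), mul_comm]
    exact mul_le_mul_of_nonneg_left (by simp) (sub_nonneg.2 hab.le)
  obtain ⟨r, V, S, hV, hS, hdisj, hcap⟩ := hX K⁻¹ ε hε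
  have hclosed : IsClosed (⋃ i, ⋃ γ ∈ S i, γ • V i)ᶜ :=
    (isOpen_iUnion fun i => isOpen_biUnion fun γ _ => (hV i).smul γ).isClosed_compl
  obtain ⟨O, hO, hCO, hμO⟩ := exists_isOpen_superset_measureReal_lt hclosed fun μ hμ => by
    have := hμ.1
    exact (ENNReal.lt_ofReal_iff_toReal_lt (measure_ne_top μ _)).1
      ((le_iSup₂_of_le μ hμ le_rfl).trans_lt hcap)
  have hord : ∀ i, HasOrderLE (iteratedJoin (S i)⁻¹ 𝒰) (a * #(S i)) := fun i => by
    simpa only [Finset.card_inv] using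
      hK _ ((hS i).isRightInvariantSet_inv.mono subset_rfl hεδ)
  choose 𝒯 hopen href hcov hmass using fun i => (hord i).exists_towerCover (hV i)
  obtain ⟨𝒱, h𝒱, h𝒱ref, h𝒱int⟩ := h𝒰.exists_glue hopen href hO fun x hx => by
    obtain ⟨i, γ, hγ, hxi⟩ : ∃ i, ∃ γ ∈ S i, x ∈ γ • V i := by
      simpa using Set.notMem_compl_iff.1 (Set.notMem_subset hCO hx)
    exact ⟨i, hcov i γ hγ x hxi⟩
  refine ⟨𝒱, h𝒱, h𝒱ref, fun μ hμ => ?_⟩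
  have htowers : ∑ i, ∑ T ∈ 𝒯 i, μ.real T ≤ a + 1 :=
    calc ∑ i, ∑ T ∈ 𝒯 i, μ.real T ≤ ∑ i, (a + 1) * (#(S i) * μ.real (V i)) :=
          Finset.sum_le_sum fun i _ => hmass i μ hμ
      _ = (a + 1) * ∑ i, #(S i) * μ.real (V i) := by rw [Finset.mul_sum]
      _ ≤ a + 1 := mul_le_of_le_one_right (by positivity)
          (sum_card_mul_measureReal_le_one hμ (fun i => (hV i).measurableSet) hdisj)
  have hrest : #𝒰 * μ.real O ≤ b - a := (by gcongr; exact (hμO μ hμ).le :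
    #𝒰 * μ.real O ≤ #𝒰 * ε).trans hεb
  linarith [h𝒱int μ hμ.1]

variable [Nonempty X]

theorem eventually_coverOrder_le_of_dynCoverDim_lt {c : ℝ} (hc : dynCoverDim Γ 𝒰 < c) :
    ∀ᶠ D in folnerFilter Γ, coverOrder (iteratedJoin D 𝒰) ≤ c * #D := by
  simp only [dynCoverDim, iInf_lt_iff] at hc
  obtain ⟨𝒱, ⟨h𝒱, href⟩, hlt⟩ := hc
  filter_upwards [eventually_hasOrderLE h𝒱 href fun μ hμ =>
    EReal.coe_lt_coe_iff.1 ((le_iSup₂_of_le μ hμ le_rfl).trans_lt hlt)] with D hD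
  exact hD.coverOrder_le

theorem HasURP.dynCoverDim_le_of_frequently (hX : HasURP Γ X) (h𝒰 : IsOpenCover 𝒰) {c : ℝ}
    (hc : 0 ≤ c) (hfreq : ∃ᶠ D in folnerFilter Γ, coverOrder (iteratedJoin D 𝒰) ≤ c * #D) :
    dynCoverDim Γ 𝒰 ≤ c := by
  refine EReal.le_of_forall_lt_iff_le.1 fun b hcb => ?_
  obtain ⟨a, hca, hab⟩ := exists_between (EReal.coe_lt_coe_iff.1 hcb)
  have hev := (isInvariantSubadditive_coverOrder h𝒰).eventually_le_of_frequently_le hc hfreq hca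
  obtain ⟨𝒱, h𝒱, href, hint⟩ := hX.exists_refinement h𝒰 (hc.trans hca.le) hab <|
    hev.mono fun D hD => (hasOrderLE_iteratedJoin h𝒰 D).hasOrderLE_coverOrder.mono hD
  exact iInf₂_le_of_le 𝒱 ⟨h𝒱, href⟩ (iSup₂_le fun μ hμ => EReal.coe_le_coe_iff.2 (hint μ hμ))

theorem HasURP.tendsto_coverOrder_div (hX : HasURP Γ X) (h𝒰 : IsOpenCover 𝒰) :
    Tendsto (fun D : Finset Γ => ((coverOrder (iteratedJoin D 𝒰) / #D : ℝ) : EReal))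
      (folnerFilter Γ) (𝓝 (dynCoverDim Γ 𝒰)) := by
  refine tendsto_order.2 ⟨fun b hb => ?_, fun b hb => ?_⟩
  · obtain ⟨c, hbc, hc⟩ := EReal.lt_iff_exists_real_btwn.1 hb
    rcases lt_or_ge c 0 with hc0 | hc0
    · exact .of_forall fun D => hbc.trans (EReal.coe_lt_coe_iff.2 (hc0.trans_le (by positivity)))
    · have hev := not_frequently.1 fun hfreq =>
        (hX.dynCoverDim_le_of_frequently h𝒰 hc0 hfreq).not_gt hc
      filter_upwards [hev, eventually_nonempty_folnerFilter] with D hD hne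
      refine hbc.trans (EReal.coe_lt_coe_iff.2 ?_)
      rwa [lt_div_iff₀ (by exact_mod_cast hne.card_pos), ← not_le]
  · obtain ⟨c, hc, hcb⟩ := EReal.lt_iff_exists_real_btwn.1 hb
    filter_upwards [eventually_coverOrder_le_of_dynCoverDim_lt hc,
      eventually_nonempty_folnerFilter] with D hD hne
    refine (EReal.coe_le_coe_iff.2 ?_).trans_lt hcb
    rwa [div_le_iff₀ (by exact_mod_cast hne.card_pos)]

omit [Nonempty X] in
theorem HasURP.tendsto_coverDim_div (hX : HasURP Γ X) (h𝒰 : IsOpenCover 𝒰) :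
    Tendsto (fun D : Finset Γ => coverDim (iteratedJoin D 𝒰) / (#D : EReal))
      (folnerFilter Γ) (𝓝 (dynCoverDim Γ 𝒰)) := by
  rcases isEmpty_or_nonempty X with _ | _
  · rw [dynCoverDim_of_isEmpty]
    refine tendsto_nhds_of_eventually_eq ?_
    filter_upwards [eventually_nonempty_folnerFilter] with D hD
    rw [coverDim_of_isEmpty]
    exact EReal.bot_div_of_pos_ne_top (by exact_mod_cast hD.card_pos) (EReal.natCast_ne_top _)
  · refine (hX.tendsto_coverOrder_div h𝒰).congr fun D => ?_
    rw [(hasOrderLE_iteratedJoin h𝒰 D).coverDim_eq, EReal.coe_div]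
    rfl

omit [DecidableEq Γ] [Nonempty X] in
theorem HasURP.hasMeanDim (hX : HasURP Γ X) (hΓ : IsAmenable Γ) :
    HasMeanDim Γ X (dynDim Γ X) := by
  classical
  exact ⟨hΓ, fun F hF => ⟨dynCoverDim Γ, fun 𝒰 h𝒰 =>
    (hX.tendsto_coverDim_div h𝒰).comp hF.tendsto_folnerFilter, rfl⟩⟩

end Comparison

end DynDim

theorem theorem9p5 :
    -- countable amenable groups and systems with the uniform Rokhlin property
    (∀ (Γ : Type*) [Group Γ] [Countable Γ] (X : Type*) [MetricSpace X] [CompactSpace X]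
        [MeasurableSpace X] [BorelSpace X] [MulAction Γ X] [ContinuousConstSMul Γ X],
        DynDim.IsAmenable Γ → DynDim.HasURP Γ X →
          DynDim.HasMeanDim Γ X (DynDim.dynDim Γ X)) ∧
    -- systems over `ℤᵏ` with the marker property
    (∀ (k : ℕ) (X : Type*) [MetricSpace X] [CompactSpace X]
        [MeasurableSpace X] [BorelSpace X] [MulAction (DynDim.ZPow k) X]
        [ContinuousConstSMul (DynDim.ZPow k) X],
        DynDim.HasMarkerProperty (DynDim.ZPow k) X →
          DynDim.HasMeanDim (DynDim.ZPow k) X (DynDim.dynDim (DynDim.ZPow k) X)) ∧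
    -- extensions of free minimal systems over `ℤᵏ`
    (∀ (k : ℕ) (X : Type*) [MetricSpace X] [CompactSpace X]
        [MeasurableSpace X] [BorelSpace X] [MulAction (DynDim.ZPow k) X]
        [ContinuousConstSMul (DynDim.ZPow k) X]
        (Y : Type*) [MetricSpace Y] [CompactSpace Y] [MulAction (DynDim.ZPow k) Y]
        [ContinuousConstSMul (DynDim.ZPow k) Y] (π : X → Y),
        DynDim.IsFactorMap (DynDim.ZPow k) π → DynDim.IsFreeAction (DynDim.ZPow k) Y →
        MulAction.IsMinimal (DynDim.ZPow k) Y →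
          DynDim.HasMeanDim (DynDim.ZPow k) X (DynDim.dynDim (DynDim.ZPow k) X)) := by
  refine ⟨?_, ?_, ?_⟩
  · intro Γ _ _ X _ _ _ _ _ _ hΓ hX
    exact hX.hasMeanDim hΓ
  · intro k X _ _ _ _ _ _ hX
    exact (DynDim.hasURP_of_hasMarkerProperty hX).hasMeanDim (DynDim.isAmenable_zPow k)
  · intro k X _ _ _ _ _ _ Y _ _ _ _ π hπ hfree hmin
    have hY := DynDim.hasMarkerProperty_of_isFreeAction_of_isMinimal hfree hmin
    exact (DynDim.hasURP_of_hasMarkerProperty (hπ.hasMarkerProperty hY)).hasMeanDim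
      (DynDim.isAmenable_zPow k)
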